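/- Let $\mathcal H$ be a separable complex Hilbert space, $L(\mathcal H)$ its bounded operators and $\mathcal T(\mathcal H)$ its trace class operators. Let ${\rm Aut}(\mathcal T(\mathcal H))$ be the group of linear bijections of $\mathcal T(\mathcal H)$ onto itself that are positive and preserve the trace norm, with the weak topology given by the functionals $u\mapsto {\rm Tr}[A\,u(S)]$, $A\in L(\mathcal H)$, $S\in\mathcal T(\mathcal H)$. Let $G$ be a locally compact, second countable, unimodular Hausdorff topological group with Haar measure $\lambda$, let $\beta:G\to{\rm Aut}(\mathcal T(\mathcal H))$, $g\mapsto\beta_g$, be a continuous group homomorphism, and let $d>0$ be a constant such that $$\int_G {\rm Tr}[P_1\beta_g(P_2)]\,d\lambda(g)=d$$ for all one-dimensional orthogonal projections $P_1,P_2$ on $\mathcal H$. Let $T\in\mathcal T(\mathcal H)$ be a positive operator of trace one. Then for each $f\in L^\infty(G,\lambda)$ the integral $$\Gamma(f)=d^{-1}\int_G f(g)\,\beta_g(T)\,d\lambda(g)$$ exists as an operator in $L(\mathcal H)$ in the ultraweak sense; that is, there is a unique $\Gamma(f)\in L(\mathcal H)$ such that for every $S\in\mathcal T(\mathcal H)$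 the function $g\mapsto f(g)\,{\rm Tr}[S\beta_g(T)]$ is $\lambda$-integrable and ${\rm Tr}[S\,\Gamma(f)]=d^{-1}\int_G f(g)\,{\rm Tr}[S\beta_g(T)]\,d\lambda(g)$. In addition, $\Gamma(1)=I$, and the map $\Gamma:L^\infty(G,\lambda)\to L(\mathcal H)$ is linear; positive ($\Gamma(f)\ge 0$ whenever $f\ge0$ almost everywhere); normal, i.e. continuous for the weak-* topologies of $L^\infty(G,\lambda)=L^1(G,\lambda)^*$ and $L(\mathcal H)=\mathcal T(\mathcal H)^*$; and $\beta$-covariant, i.e. $\beta_g^*(\Gamma(f))=\Gamma(f(g\,\cdot))$ for all $f\in L^\infty(G,\lambda)$ and $g\in G$, where $\beta_g^*:L(\mathcal H)\to L(\mathcal H)$ is the adjoint of $\beta_g$, ${\rm Tr}[S\,\beta_g^*(A)]={\rm Tr}[\beta_g(S)A]$. -/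

import Mathlib

open MeasureTheory
open scoped ENNReal InnerProductSpace ComplexOrder Topology

noncomputable section

namespace PhaseSpace

section TraceClass

variable {H : Type*} [NormedAddCommGroup H] [InnerProductSpace ℂ H]

theorem tsum_enorm_inner_sq {ι : Type*} (b : HilbertBasis ι ℂ H) (x : H) :
    ∑' i, ENNReal.ofReal (‖⟪b i, x⟫_ℂ‖ ^ 2) = ENNReal.ofReal (‖x‖ ^ 2) := by
  have h := b.hasSum_inner_mul_inner x x
  have h2 : HasSum (fun i => ‖⟪b i, x⟫_ℂ‖ ^ 2) (‖x‖ ^ 2) := by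
    have := Complex.hasSum_re h
    convert! this using 1
    · ext i
      rw [← inner_conj_symm x (b i), RCLike.conj_mul]
      norm_cast
    · rw [inner_self_eq_norm_sq_to_K]; norm_cast
  rw [← ENNReal.ofReal_tsum_of_nonneg (fun i => by positivity) h2.summable, h2.tsum_eq]

variable [CompleteSpace H]

theorem tsum_norm_sq_adjoint {ι κ : Type*} (b : HilbertBasis ι ℂ H) (c : HilbertBasis κ ℂ H)
    (X : H →L[ℂ] H) :
    ∑' i, ENNReal.ofReal (‖X (b i)‖ ^ 2) = ∑' j, ENNReal.ofReal (‖X.adjoint (c j)‖ ^ 2) := by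
  simp_rw [← tsum_enorm_inner_sq c (X (b _)), ← tsum_enorm_inner_sq b (X.adjoint (c _))]
  rw [ENNReal.tsum_comm]
  refine tsum_congr fun j => tsum_congr fun i => ?_
  rw [ContinuousLinearMap.adjoint_inner_right, norm_inner_symm]

theorem tsum_norm_sq_comp_le {ι : Type*} (b : HilbertBasis ι ℂ H) (X W : H →L[ℂ] H)
    (hW : ‖W‖ ≤ 1) :
    ∑' i, ENNReal.ofReal (‖X (W (b i))‖ ^ 2) ≤ ∑' i, ENNReal.ofReal (‖X (b i)‖ ^ 2) := by
  have h1 := tsum_norm_sq_adjoint b b (X * W)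
  have h2 := tsum_norm_sq_adjoint b b X
  simp only [mul_apply_eq_comp] at h1
  rw [h1, h2]
  refine ENNReal.tsum_le_tsum fun i => ENNReal.ofReal_le_ofReal ?_
  have : (X * W).adjoint = W.adjoint * X.adjoint := ContinuousLinearMap.adjoint_comp X W
  rw [this, mul_apply_eq_comp]
  gcongr
  refine (W.adjoint.le_opNorm _).trans ?_
  have : ‖W.adjoint‖ ≤ 1 := by rwa [LinearIsometryEquiv.norm_map]
  nlinarith [norm_nonneg (X.adjoint (b i))]

/-- Polar decomposition: `A = V|A|` and `|A| = V*A` for some contraction `V`. -/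
theorem exists_polar (A : H →L[ℂ] H) :
    ∃ V : H →L[ℂ] H, ‖V‖ ≤ 1 ∧ A = V * CFC.abs A ∧ CFC.abs A = V.adjoint * A := by
  set P := CFC.abs A with hP
  have hPsa : P.adjoint = P := (CFC.abs_nonneg A).isSelfAdjoint
  have hPP : P * P = A.adjoint * A := CFC.abs_mul_abs A
  have hin : ∀ x y, ⟪P x, P y⟫_ℂ = ⟪A x, A y⟫_ℂ := fun x y => by
    rw [← ContinuousLinearMap.adjoint_inner_right, hPsa,
      ← ContinuousLinearMap.adjoint_inner_right A]
    exact congrArg (fun Z : H →L[ℂ] H => ⟪x, Z y⟫_ℂ) hPP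
  have hno : ∀ x, ‖A x‖ = ‖P x‖ := fun x => by
    have := hin x x
    rw [inner_self_eq_norm_sq_to_K, inner_self_eq_norm_sq_to_K] at this
    norm_cast at this
    exact ((sq_eq_sq₀ (norm_nonneg _) (norm_nonneg _)).1 this).symm
  let K : Submodule ℂ H := (LinearMap.range (P : H →ₗ[ℂ] H)).topologicalClosure
  have hPK : ∀ x, P x ∈ K := fun x =>
    Submodule.le_topologicalClosure _ (LinearMap.mem_range_self (P : H →ₗ[ℂ] H) x)
  have : CompleteSpace K := (Submodule.isClosed_topologicalClosure _).completeSpace_coe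
  let e : H →ₗ[ℂ] K := (P : H →ₗ[ℂ] H).codRestrict K hPK
  have he : DenseRange e := by
    intro y
    rw [closure_subtype]
    have : ((↑) '' Set.range e : Set H) = Set.range P := by
      ext z; constructor
      · rintro ⟨_, ⟨x, rfl⟩, rfl⟩; exact ⟨x, rfl⟩
      · rintro ⟨x, rfl⟩; exact ⟨e x, ⟨x, rfl⟩, rfl⟩
    rw [this]
    exact y.2
  have hb : ∀ x, ‖(A : H →ₗ[ℂ] H) x‖ ≤ 1 * ‖e x‖ := fun x => by
    rw [one_mul]; exact (hno x).le
  let V₀ : K →L[ℂ] H := (A : H →ₗ[ℂ] H).extendOfNorm e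
  have hV₀ : ‖V₀‖ ≤ 1 := LinearMap.opNorm_extendOfNorm_le he zero_le_one hb
  let V : H →L[ℂ] H := V₀ ∘L K.orthogonalProjectionOnto
  have hVP : ∀ x, V (P x) = A x := fun x => by
    have h1 : K.orthogonalProjectionOnto (P x) = e x :=
      K.orthogonalProjectionOnto_mem_subspace_eq_self (e x)
    change V₀ (K.orthogonalProjectionOnto (P x)) = A x
    rw [h1]
    exact LinearMap.extendOfNorm_eq he ⟨1, hb⟩ x
  have hVK : ∀ z, V z = V (K.orthogonalProjectionOnto z) := fun z => by
    change V₀ (K.orthogonalProjectionOnto z) =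
      V₀ (K.orthogonalProjectionOnto (K.orthogonalProjectionOnto z : H))
    exact congrArg V₀ (K.orthogonalProjectionOnto_mem_subspace_eq_self _).symm
  refine ⟨V, ?_, ?_, ?_⟩
  · refine (ContinuousLinearMap.opNorm_comp_le _ _).trans ?_
    have := K.orthogonalProjectionOnto_norm_le
    nlinarith [norm_nonneg V₀, norm_nonneg K.orthogonalProjectionOnto]
  · ext x; exact (hVP x).symm
  · ext y
    refine ext_inner_left ℂ fun z => ?_
    rw [mul_apply_eq_comp, ContinuousLinearMap.adjoint_inner_right]
    have key : ∀ k : K, ⟪(k : H), P y⟫_ℂ = ⟪V k, A y⟫_ℂ := by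
      refine he.induction ?_ (isClosed_eq (by fun_prop) (by fun_prop))
      rintro _ ⟨x, rfl⟩
      change ⟪P x, P y⟫_ℂ = ⟪V (P x), A y⟫_ℂ
      rw [hVP, hin]
    rw [hVK z, ← key]
    have : ⟪(K.orthogonalProjectionOnto z : H), ((⟨P y, hPK y⟩ : K) : H)⟫_ℂ = _ :=
      K.inner_orthogonalProjectionOnto_eq_of_mem_right ⟨P y, hPK y⟩ z
    exact this.symm


/-- For positive `P`, `⟨x, P x⟩ = ‖√P x‖²`. -/
theorem re_inner_eq_norm_sqrt_sq {P : H →L[ℂ] H} (hP : 0 ≤ P) (x : H) :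
    (⟪x, P x⟫_ℂ).re = ‖CFC.sqrt P x‖ ^ 2 := by
  have h1 : (CFC.sqrt P).adjoint = CFC.sqrt P := (CFC.sqrt_nonneg P).isSelfAdjoint
  have h2 : CFC.sqrt P * CFC.sqrt P = P := CFC.sqrt_mul_sqrt_self P hP
  conv_lhs => rw [← h2]
  rw [mul_apply_eq_comp, ← ContinuousLinearMap.adjoint_inner_left, h1,
    inner_self_eq_norm_sq_to_K]
  norm_cast

/-- `∑ ⟨bᵢ, |A| bᵢ⟩` in `[0, ∞]`, for an orthonormal basis `b`. -/
def traceNormIn {ι : Type*} (b : HilbertBasis ι ℂ H) (A : H →L[ℂ] H) : ℝ≥0∞ :=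
  ∑' i, ENNReal.ofReal (⟪b i, CFC.abs A (b i)⟫_ℂ).re

theorem traceNormIn_eq {ι : Type*} (b : HilbertBasis ι ℂ H) (A : H →L[ℂ] H) :
    traceNormIn b A = ∑' i, ENNReal.ofReal (‖CFC.sqrt (CFC.abs A) (b i)‖ ^ 2) := by
  simp only [traceNormIn, re_inner_eq_norm_sqrt_sq (CFC.abs_nonneg A)]

/-- The value of `traceNormIn` does not depend on the basis. -/
theorem traceNormIn_basis_indep {ι κ : Type*} (b : HilbertBasis ι ℂ H) (c : HilbertBasis κ ℂ H)
    (A : H →L[ℂ] H) : traceNormIn b A = traceNormIn c A := by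
  have h1 : (CFC.sqrt (CFC.abs A)).adjoint = CFC.sqrt (CFC.abs A) :=
    (CFC.sqrt_nonneg _).isSelfAdjoint
  rw [traceNormIn_eq, traceNormIn_eq, tsum_norm_sq_adjoint b c, h1]

theorem tsum_norm_inner_le {ι : Type*} (b : HilbertBasis ι ℂ H) (A W : H →L[ℂ] H)
    (hW : ‖W‖ ≤ 1) :
    ∑' i, ENNReal.ofReal ‖⟪W (b i), A (b i)⟫_ℂ‖ ≤ traceNormIn b A := by
  obtain ⟨V, hV, hA, -⟩ := exists_polar A
  set R := CFC.sqrt (CFC.abs A) with hR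
  have hRsa : R.adjoint = R := (CFC.sqrt_nonneg _).isSelfAdjoint
  have hRR : R * R = CFC.abs A := CFC.sqrt_mul_sqrt_self _ (CFC.abs_nonneg A)
  have hK : ‖V.adjoint * W‖ ≤ 1 := by
    refine (norm_mul_le _ _).trans ?_
    have : ‖V.adjoint‖ ≤ 1 := by rwa [LinearIsometryEquiv.norm_map]
    nlinarith [norm_nonneg V.adjoint, norm_nonneg W]
  have hpt : ∀ x, ‖⟪W x, A x⟫_ℂ‖ ≤
      (1 / 2) * ‖R ((V.adjoint * W) x)‖ ^ 2 + (1 / 2) * ‖R x‖ ^ 2 := fun x => by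
    have : ⟪W x, A x⟫_ℂ = ⟪R ((V.adjoint * W) x), R x⟫_ℂ := by
      conv_lhs => rw [hA, ← hRR]
      simp only [mul_apply_eq_comp]
      rw [← ContinuousLinearMap.adjoint_inner_left V, ← ContinuousLinearMap.adjoint_inner_left R,
        hRsa]
    rw [this]
    refine (norm_inner_le_norm _ _).trans ?_
    nlinarith [sq_nonneg (‖R ((V.adjoint * W) x)‖ - ‖R x‖)]
  calc ∑' i, ENNReal.ofReal ‖⟪W (b i), A (b i)⟫_ℂ‖
      ≤ ∑' i, (ENNReal.ofReal (1 / 2) * ENNReal.ofReal (‖R ((V.adjoint * W) (b i))‖ ^ 2)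
          + ENNReal.ofReal (1 / 2) * ENNReal.ofReal (‖R (b i)‖ ^ 2)) := by
        refine ENNReal.tsum_le_tsum fun i => ?_
        rw [← ENNReal.ofReal_mul (by norm_num), ← ENNReal.ofReal_mul (by norm_num),
          ← ENNReal.ofReal_add (by positivity) (by positivity)]
        exact ENNReal.ofReal_le_ofReal (hpt _)
    _ ≤ ENNReal.ofReal (1 / 2) * traceNormIn b A + ENNReal.ofReal (1 / 2) * traceNormIn b A := by
        rw [ENNReal.tsum_add, ENNReal.tsum_mul_left, ENNReal.tsum_mul_left, traceNormIn_eq]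
        exact add_le_add (mul_le_mul_right (tsum_norm_sq_comp_le b R _ hK) _) le_rfl
    _ = traceNormIn b A := by
        rw [← add_mul, ← ENNReal.ofReal_add (by norm_num) (by norm_num)]
        norm_num

theorem traceNormIn_add_le {ι : Type*} (b : HilbertBasis ι ℂ H) (A B : H →L[ℂ] H) :
    traceNormIn b (A + B) ≤ traceNormIn b A + traceNormIn b B := by
  obtain ⟨V, hV, -, hAB⟩ := exists_polar (A + B)
  refine le_trans ?_ (add_le_add (tsum_norm_inner_le b A V hV) (tsum_norm_inner_le b B V hV))
  rw [← ENNReal.tsum_add, traceNormIn]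
  refine ENNReal.tsum_le_tsum fun i => ?_
  rw [← ENNReal.ofReal_add (norm_nonneg _) (norm_nonneg _), hAB,
    mul_apply_eq_comp, ContinuousLinearMap.adjoint_inner_right,
    add_apply, inner_add_right, Complex.add_re]
  exact ENNReal.ofReal_le_ofReal
    (add_le_add (Complex.re_le_norm _) (Complex.re_le_norm _))

theorem traceNormIn_smul {ι : Type*} (b : HilbertBasis ι ℂ H) (z : ℂ) (A : H →L[ℂ] H) :
    traceNormIn b (z • A) = ENNReal.ofReal ‖z‖ * traceNormIn b A := by
  rw [traceNormIn, traceNormIn, ← ENNReal.tsum_mul_left]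
  refine tsum_congr fun i => ?_
  rw [CFC.abs_smul, ← ENNReal.ofReal_mul (norm_nonneg _)]
  congr 1
  change (⟪b i, ‖z‖ • (CFC.abs A (b i))⟫_ℂ).re = _
  rw [inner_smul_right_eq_smul]
  simp

/-- `∑ ⟨X bᵢ, Y bᵢ⟩` for `X`, `Y` square summable on orthonormal bases, after a change of basis. -/
theorem tsum_inner_swap {ι κ : Type*} (b : HilbertBasis ι ℂ H) (c : HilbertBasis κ ℂ H)
    (X Y : H →L[ℂ] H) (hX : ∑' i, ENNReal.ofReal (‖X (b i)‖ ^ 2) ≠ ∞)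
    (hY : ∑' i, ENNReal.ofReal (‖Y (b i)‖ ^ 2) ≠ ∞) :
    ∑' i, ⟪X (b i), Y (b i)⟫_ℂ = ∑' j, ⟪Y.adjoint (c j), X.adjoint (c j)⟫_ℂ := by
  have hs : ∀ Z : H →L[ℂ] H, ∑' i, ENNReal.ofReal (‖Z (b i)‖ ^ 2) ≠ ∞ →
      Summable fun p : ι × κ => ‖⟪c p.2, Z (b p.1)⟫_ℂ‖ ^ 2 := fun Z hZ => by
    simp_rw [← tsum_enorm_inner_sq c] at hZ
    rw [← ENNReal.tsum_prod] at hZ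
    have := ENNReal.summable_toReal hZ
    refine this.congr fun p => ?_
    rw [ENNReal.toReal_ofReal (by positivity)]
  have hsum : Summable fun p : ι × κ => ⟪X (b p.1), c p.2⟫_ℂ * ⟪c p.2, Y (b p.1)⟫_ℂ := by
    refine Summable.of_norm_bounded ((hs X hX).add (hs Y hY)) fun p => ?_
    rw [norm_mul, norm_inner_symm (X (b p.1))]
    have key : ∀ s t : ℝ, s * t ≤ s ^ 2 + t ^ 2 := fun s t => by
      nlinarith [sq_nonneg (s - t), sq_nonneg s, sq_nonneg t]
    exact key _ _
  have hl : ∀ i, ⟪X (b i), Y (b i)⟫_ℂ = ∑' j, ⟪X (b i), c j⟫_ℂ * ⟪c j, Y (b i)⟫_ℂ :=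
    fun i => (c.tsum_inner_mul_inner _ _).symm
  have hr : ∀ j, ⟪Y.adjoint (c j), X.adjoint (c j)⟫_ℂ =
      ∑' i, ⟪Y.adjoint (c j), b i⟫_ℂ * ⟪b i, X.adjoint (c j)⟫_ℂ :=
    fun j => (b.tsum_inner_mul_inner _ _).symm
  calc ∑' i, ⟪X (b i), Y (b i)⟫_ℂ
      = ∑' i, ∑' j, ⟪X (b i), c j⟫_ℂ * ⟪c j, Y (b i)⟫_ℂ := tsum_congr hl
    _ = ∑' j, ∑' i, ⟪X (b i), c j⟫_ℂ * ⟪c j, Y (b i)⟫_ℂ :=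
        (Summable.tsum_comm (f := fun i j => ⟪X (b i), c j⟫_ℂ * ⟪c j, Y (b i)⟫_ℂ) hsum).symm
    _ = ∑' j, ∑' i, ⟪Y.adjoint (c j), b i⟫_ℂ * ⟪b i, X.adjoint (c j)⟫_ℂ := by
        refine tsum_congr fun j => tsum_congr fun i => ?_
        rw [ContinuousLinearMap.adjoint_inner_left, ContinuousLinearMap.adjoint_inner_right,
          mul_comm]
    _ = _ := (tsum_congr hr).symm

/-- For trace class `A`, the sum of diagonal entries does not depend on the basis. -/
theorem trace_basis_indep {ι κ : Type*} (b : HilbertBasis ι ℂ H) (c : HilbertBasis κ ℂ H)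
    (A : H →L[ℂ] H) (hA : traceNormIn b A ≠ ∞) :
    ∑' i, ⟪b i, A (b i)⟫_ℂ = ∑' j, ⟪c j, A (c j)⟫_ℂ := by
  obtain ⟨V, hV, hVA, -⟩ := exists_polar A
  set R := CFC.sqrt (CFC.abs A) with hR
  have hRsa : R.adjoint = R := (CFC.sqrt_nonneg _).isSelfAdjoint
  have hRR : R * R = CFC.abs A := CFC.sqrt_mul_sqrt_self _ (CFC.abs_nonneg A)
  have hpt : ∀ x, ⟪x, A x⟫_ℂ = ⟪(R * V.adjoint) x, R x⟫_ℂ := fun x => by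
    conv_lhs => rw [hVA, ← hRR]
    simp only [mul_apply_eq_comp]
    rw [← ContinuousLinearMap.adjoint_inner_left V, ← ContinuousLinearMap.adjoint_inner_left R,
      hRsa]
  have hV' : ‖V.adjoint‖ ≤ 1 := by rwa [LinearIsometryEquiv.norm_map]
  have hc := hA
  rw [traceNormIn_eq] at hA
  rw [traceNormIn_basis_indep b c, traceNormIn_eq] at hc
  rw [← hR] at hA hc
  clear_value R
  have hA' : ∑' i, ENNReal.ofReal (‖(R * V.adjoint) (b i)‖ ^ 2) ≠ ∞ :=
    ne_top_of_le_ne_top hA (tsum_norm_sq_comp_le b R _ hV')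
  have hc' : ∑' i, ENNReal.ofReal (‖(R * V.adjoint) (c i)‖ ^ 2) ≠ ∞ :=
    ne_top_of_le_ne_top hc (tsum_norm_sq_comp_le c R _ hV')
  calc ∑' i, ⟪b i, A (b i)⟫_ℂ
      = ∑' i, ⟪(R * V.adjoint) (b i), R (b i)⟫_ℂ := tsum_congr fun i => hpt (b i)
    _ = ∑' j, ⟪R.adjoint (c j), (R * V.adjoint).adjoint (c j)⟫_ℂ :=
        tsum_inner_swap b c _ _ hA' hA
    _ = ∑' j, ⟪(R * V.adjoint) (c j), R (c j)⟫_ℂ :=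
        (tsum_inner_swap c c _ _
          hc' hc).symm
    _ = ∑' j, ⟪c j, A (c j)⟫_ℂ := (tsum_congr fun j => hpt (c j)).symm

variable (H) in
/-- Index type of a fixed orthonormal basis of `H`. -/
def basisIndex : Set H := (exists_hilbertBasis ℂ H).choose

variable (H) in
/-- A fixed orthonormal basis of `H`. -/
def onb : HilbertBasis (basisIndex H) ℂ H := (exists_hilbertBasis ℂ H).choose_spec.choose

/-- The trace norm `Tr |A|` in `[0, ∞]` of a bounded operator. -/
def traceNorm (A : H →L[ℂ] H) : ℝ≥0∞ := traceNormIn (onb H) A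

/-- The trace `∑ ⟨bᵢ, A bᵢ⟩`; only used for trace class operators. -/
def trace (A : H →L[ℂ] H) : ℂ := ∑' i, ⟪onb H i, A (onb H i)⟫_ℂ

variable (H) in
/-- The space of trace class operators, those with `Tr |A| < ∞`. -/
def traceClass : Submodule ℂ (H →L[ℂ] H) where
  carrier := {A | traceNorm A < ∞}
  zero_mem' := by simp [traceNorm, traceNormIn]
  add_mem' {A B} hA hB :=
    (traceNormIn_add_le (onb H) A B).trans_lt (ENNReal.add_lt_top.2 ⟨hA, hB⟩)
  smul_mem' z A hA := by
    change traceNormIn (onb H) (z • A) < ∞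
    rw [traceNormIn_smul]
    exact ENNReal.mul_lt_top ENNReal.ofReal_lt_top hA

theorem mem_traceClass_iff {ι : Type*} (b : HilbertBasis ι ℂ H) (A : H →L[ℂ] H) :
    A ∈ traceClass H ↔ traceNormIn b A < ∞ := by
  rw [traceNormIn_basis_indep b (onb H)]
  exact Iff.rfl

theorem trace_eq_tsum {ι : Type*} (b : HilbertBasis ι ℂ H) {A : H →L[ℂ] H}
    (hA : A ∈ traceClass H) : trace A = ∑' i, ⟪b i, A (b i)⟫_ℂ :=
  trace_basis_indep (onb H) b A (ne_of_lt hA)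

variable (H) in
/-- The linear bijections of the trace class onto itself which are positive and preserve the
trace norm. Such a map is a homeomorphism for the trace norm, being isometric and onto. -/
def traceAut : Submonoid (traceClass H ≃ₗ[ℂ] traceClass H) where
  carrier := {u | (∀ S : traceClass H, (S : H →L[ℂ] H).IsPositive → (u S : H →L[ℂ] H).IsPositive) ∧
    ∀ S : traceClass H, traceNorm (u S : H →L[ℂ] H) = traceNorm (S : H →L[ℂ] H)}
  one_mem' := ⟨fun _ h => h, fun _ => rfl⟩
  mul_mem' {_ v} hu hv :=
    ⟨fun S hS => hu.1 (v S) (hv.1 S hS), fun S => (hu.2 (v S)).trans (hv.2 S)⟩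

/-- The weak topology on `traceAut H` given by the functionals `u ↦ Tr (A u(S))`, with `A` bounded
and `S` trace class. -/
instance traceAut.instTopologicalSpace : TopologicalSpace (traceAut H) :=
  TopologicalSpace.induced
    (fun (u : traceAut H) (p : (H →L[ℂ] H) × traceClass H) =>
      trace (p.1 * (u.1 p.2 : H →L[ℂ] H)))
    inferInstance

/-- One-dimensional orthogonal projections. -/
def IsOneDimProjection (P : H →L[ℂ] H) : Prop :=
  IsStarProjection P ∧ Module.finrank ℂ (LinearMap.range (P : H →ₗ[ℂ] H)) = 1

variable (H) in
/-- The ultraweak topology on the bounded operators: the weak-* topology for the duality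
`⟨S, A⟩ = Tr (S A)` with the trace class. -/
@[reducible] def ultraweakTopology : TopologicalSpace (H →L[ℂ] H) :=
  TopologicalSpace.induced
    (fun (A : H →L[ℂ] H) (S : traceClass H) => trace ((S : H →L[ℂ] H) * A)) inferInstance

/-- `A = ∫ F dμ` in the ultraweak sense: for each trace class `S` the function `Tr (S F(·))` is
integrable, with integral `Tr (S A)`. -/
def HasUltraweakIntegral {Ω : Type*} [MeasurableSpace Ω] (μ : Measure Ω) (F : Ω → H →L[ℂ] H)
    (A : H →L[ℂ] H) : Prop :=
  ∀ S : traceClass H, Integrable (fun x => trace ((S : H →L[ℂ] H) * F x)) μ ∧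
    ∫ x, trace ((S : H →L[ℂ] H) * F x) ∂μ = trace ((S : H →L[ℂ] H) * A)

/-- `B = u*(A)`, where `u*` is the adjoint of `u` for the duality `⟨S, A⟩ = Tr (S A)`. -/
def IsAdjointImage (u : traceClass H ≃ₗ[ℂ] traceClass H) (A B : H →L[ℂ] H) : Prop :=
  ∀ S : traceClass H, trace ((S : H →L[ℂ] H) * B) = trace ((u S : H →L[ℂ] H) * A)

end TraceClass

section LInfty

variable {Ω : Type*} [MeasurableSpace Ω]

/-- The weak-* topology on `L^∞(μ)` for the duality `⟨f, h⟩ = ∫ f h dμ` with `L^1(μ)`. -/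
@[reducible] def weakStarTopology (μ : Measure Ω) : TopologicalSpace (Lp ℂ ∞ μ) :=
  TopologicalSpace.induced (fun (f : Lp ℂ ∞ μ) (h : Lp ℂ 1 μ) => ∫ x, f x * h x ∂μ) inferInstance

/-- The constant function `1` in `L^∞(μ)`. -/
def oneLInfty (μ : Measure Ω) : Lp ℂ ∞ μ := (memLp_top_const (μ := μ) (1 : ℂ)).toLp

variable {H : Type*} [NormedAddCommGroup H] [InnerProductSpace ℂ H] [CompleteSpace H]

/-- A linear map from `L^∞(μ)` to the bounded operators is positive if it maps (almost everywhere)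
nonnegative functions to positive operators. -/
def IsPositiveMap (μ : Measure Ω) (Γ : Lp ℂ ∞ μ →ₗ[ℂ] (H →L[ℂ] H)) : Prop :=
  ∀ f : Lp ℂ ∞ μ, (∀ᵐ x ∂μ, 0 ≤ f x) → (Γ f).IsPositive

/-- A linear map from `L^∞(μ)` to the bounded operators is normal if it is weak-* continuous. -/
def IsNormalMap (μ : Measure Ω) (Γ : Lp ℂ ∞ μ →ₗ[ℂ] (H →L[ℂ] H)) : Prop :=
  Continuous[weakStarTopology μ, ultraweakTopology H] Γ

variable {G : Type*} [Group G] [MeasurableSpace G] [MeasurableMul G]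

/-- The left translate `x ↦ f (g x)` of `f ∈ L^∞(μ)`. -/
def translate (μ : Measure G) [μ.IsMulLeftInvariant] (g : G) (f : Lp ℂ ∞ μ) : Lp ℂ ∞ μ :=
  Lp.compMeasurePreserving (fun x => g * x) (measurePreserving_mul_left μ g) f

/-- Covariance: `β_g*(Γ(f)) = Γ(f(g ·))`. -/
def IsCovariantMap (μ : Measure G) [μ.IsMulLeftInvariant] (β : G →* traceAut H)
    (Γ : Lp ℂ ∞ μ →ₗ[ℂ] (H →L[ℂ] H)) : Prop :=
  ∀ (g : G) (f : Lp ℂ ∞ μ), IsAdjointImage (β g).1 (Γ f) (Γ (translate μ g f))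

end LInfty

end PhaseSpace

end

/-!
The operators `X g = d⁻¹ β_g(T)` are the density of a positive operator valued measure with total
mass `1`, and `Γ f = ∫ f X` is integration against it. Two facts carry the argument.

*Integrability.* In trace norm, `T = ∑ |R bᵢ⟩⟨R bᵢ|` with `R = √T` and `(bᵢ)` an orthonormal basis
(`IsTraceNormBounded.hasSum_of_sq`), and `β_g` is isometric, so monotone convergence extends the
orthogonality relation from one-dimensional projections to `∫ ⟨x, β_g(T) x⟩ dg = d ‖x‖²`
(`lintegral_inner_map`). A trace class `S` is likewise a sum `∑ |V R bᵢ⟩⟨R bᵢ|`, where `|S| = R²` and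
`S = V |S|`, and the Cauchy-Schwarz inequality for the positive operators `X g` gives
`∫ |Tr (S X g)| dg ≤ ‖S‖₁` (`IsResolutionDensity.lintegral_enorm_trace_mul_le`). Thus
`S ↦ ∫ f Tr (S X)` is a bounded functional on the trace class, that is, `S ↦ Tr (S Γ f)` for a
unique bounded operator `Γ f` (`IsTraceNormBounded.exists_eq_trace_mul`). Linearity, positivity,
`Γ 1 = 1` and normality can be read off this formula.

*Covariance.* By left invariance of the measure it amounts to `Tr (β_g(S) β_g(T)) = Tr (S T)`
(`trace_map_mul_map`). Wigner's theorem is not needed for this: `β_g` and its inverse preserve the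
order, so `β_g` maps the operators `|x⟩⟨x|` to operators of the same form, these being the minimal
positive ones; and transition probabilities are preserved because
`‖|x⟩⟨x| - |y⟩⟨y|‖₁ = 2 √(1 - |⟨x, y⟩|²)` for unit vectors. As a bounded functional on the trace
class is determined by its values on the operators `|x⟩⟨x|` (`IsTraceNormBounded.eq_zero`), the
identity holds for all `S` and `T`.
-/

namespace PhaseSpace

open InnerProductSpace

/-! ### The trace class as an ideal and its dual -/

section TraceIdeal

variable {H : Type*} [NormedAddCommGroup H] [InnerProductSpace ℂ H] [CompleteSpace H]

theorem traceNorm_smul (z : ℂ) (A : H →L[ℂ] H) :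
    traceNorm (z • A) = ENNReal.ofReal ‖z‖ * traceNorm A :=
  traceNormIn_smul _ z A

theorem traceNorm_ne_top (S : traceClass H) : traceNorm (S : H →L[ℂ] H) ≠ ∞ :=
  ne_of_lt S.2

/-- The trace class is a left ideal, with `‖X A‖₁ ≤ ‖X‖ ‖A‖₁`. -/
theorem traceNorm_mul_le (X A : H →L[ℂ] H) :
    traceNorm (X * A) ≤ ENNReal.ofReal ‖X‖ * traceNorm A := by
  have contr : ∀ Y : H →L[ℂ] H, ‖Y‖ ≤ 1 → traceNorm (Y * A) ≤ traceNorm A := fun Y hY => by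
    obtain ⟨V, hV, -, hVA⟩ := exists_polar (Y * A)
    have hW : ‖Y.adjoint * V‖ ≤ 1 := by
      refine (norm_mul_le _ _).trans ?_
      rw [LinearIsometryEquiv.norm_map]
      exact mul_le_one₀ hY (norm_nonneg _) hV
    refine le_trans (ENNReal.tsum_le_tsum fun i => ?_) (tsum_norm_inner_le (onb H) A _ hW)
    refine ENNReal.ofReal_le_ofReal ?_
    rw [hVA, mul_apply_eq_comp, mul_apply_eq_comp, mul_apply_eq_comp,
      ContinuousLinearMap.adjoint_inner_right, ContinuousLinearMap.adjoint_inner_left]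
    exact Complex.re_le_norm _
  rcases eq_or_ne X 0 with rfl | hX
  · simp [traceNorm, traceNormIn]
  · have hn : (‖X‖ : ℂ) ≠ 0 := by exact_mod_cast norm_ne_zero_iff.2 hX
    have h1 : X * A = (‖X‖ : ℂ) • (((‖X‖ : ℂ)⁻¹ • X) * A) := by
      rw [smul_mul_assoc, smul_smul, mul_inv_cancel₀ hn, one_smul]
    rw [h1, traceNorm_smul]
    simp only [Complex.norm_real, norm_norm]
    gcongr
    refine contr _ ?_
    rw [norm_smul, norm_inv, Complex.norm_real, norm_norm,
      inv_mul_cancel₀ (norm_ne_zero_iff.2 hX)]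

theorem mul_mem_traceClass (X : H →L[ℂ] H) {A : H →L[ℂ] H} (hA : A ∈ traceClass H) :
    X * A ∈ traceClass H :=
  (traceNorm_mul_le X A).trans_lt (ENNReal.mul_lt_top ENNReal.ofReal_lt_top hA)

/-- Left multiplication by a bounded operator on the trace class. -/
noncomputable def leftMul (X : H →L[ℂ] H) : traceClass H →ₗ[ℂ] traceClass H where
  toFun S := ⟨X * S, mul_mem_traceClass X S.2⟩
  map_add' S S' := Subtype.ext (mul_add X (S : H →L[ℂ] H) S')
  map_smul' c S := Subtype.ext (mul_smul_comm c X (S : H →L[ℂ] H))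

@[simp] theorem coe_leftMul (X : H →L[ℂ] H) (S : traceClass H) :
    (leftMul X S : H →L[ℂ] H) = X * S := rfl

theorem tsum_ofReal_norm_inner_le (A : H →L[ℂ] H) :
    ∑' i, ENNReal.ofReal ‖⟪onb H i, A (onb H i)⟫_ℂ‖ ≤ traceNorm A := by
  change _ ≤ traceNormIn _ _
  simpa using tsum_norm_inner_le (onb H) A 1 ContinuousLinearMap.norm_id_le

theorem summable_norm_inner {A : H →L[ℂ] H} (hA : A ∈ traceClass H) :
    Summable fun i => ‖⟪onb H i, A (onb H i)⟫_ℂ‖ := by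
  have h := ENNReal.summable_toReal
    (ne_top_of_le_ne_top (ne_of_lt hA) (tsum_ofReal_norm_inner_le A))
  simpa only [ENNReal.toReal_ofReal (norm_nonneg _)] using h

theorem norm_trace_le {A : H →L[ℂ] H} (hA : A ∈ traceClass H) :
    ‖trace A‖ ≤ (traceNorm A).toReal := by
  refine (norm_tsum_le_tsum_norm (summable_norm_inner hA)).trans ?_
  rw [← ENNReal.ofReal_le_iff_le_toReal (ne_of_lt hA),
    ENNReal.ofReal_tsum_of_nonneg (fun _ => norm_nonneg _) (summable_norm_inner hA)]
  exact tsum_ofReal_norm_inner_le A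

/-- The trace as a linear functional on the trace class. -/
noncomputable def traceLin : traceClass H →ₗ[ℂ] ℂ where
  toFun S := trace (S : H →L[ℂ] H)
  map_add' S S' := by
    rw [trace, trace, trace, ← Summable.tsum_add (summable_norm_inner S.2).of_norm
      (summable_norm_inner S'.2).of_norm]
    exact tsum_congr fun i => inner_add_right _ _ _
  map_smul' c S := by
    rw [trace, trace, RingHom.id_apply, smul_eq_mul, ← tsum_mul_left]
    exact tsum_congr fun i => inner_smul_right _ _ _

@[simp] theorem traceLin_apply (S : traceClass H) : traceLin S = trace (S : H →L[ℂ] H) := rfl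

theorem trace_smul (c : ℂ) (A : H →L[ℂ] H) : trace (c • A) = c * trace A := by
  rw [trace, trace, ← tsum_mul_left]
  exact tsum_congr fun i => inner_smul_right _ _ _

theorem trace_of_nonneg {P : H →L[ℂ] H} (hP : 0 ≤ P) :
    trace P = ((traceNorm P).toReal : ℂ) := by
  have hpos : ∀ x, ⟪x, P x⟫_ℂ = ((⟪x, P x⟫_ℂ).re : ℂ) := fun x =>
    (Complex.eq_re_of_ofReal_le
      (((ContinuousLinearMap.nonneg_iff_isPositive P).1 hP).inner_nonneg_right x))
  rw [trace, traceNorm, traceNormIn, CFC.abs_of_nonneg P, ENNReal.tsum_toReal_eq (by simp),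
    Complex.ofReal_tsum]
  refine tsum_congr fun i => ?_
  rw [ENNReal.toReal_ofReal (by rw [re_inner_eq_norm_sqrt_sq hP]; positivity)]
  exact hpos _

/-- A trace class operator factors as `A = V R²` with `V` a contraction and `R` a self-adjoint
Hilbert-Schmidt operator whose squared Hilbert-Schmidt norm is `‖A‖₁`. -/
theorem exists_factorization (A : H →L[ℂ] H) :
    ∃ V R : H →L[ℂ] H, ‖V‖ ≤ 1 ∧ R.adjoint = R ∧ A = V * (R * R) ∧
      ∑' i, ENNReal.ofReal (‖R (onb H i)‖ ^ 2) = traceNorm A := by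
  obtain ⟨V, hV, hA, -⟩ := exists_polar A
  refine ⟨V, CFC.sqrt (CFC.abs A), hV, (CFC.sqrt_nonneg _).isSelfAdjoint, ?_,
    (traceNormIn_eq _ _).symm⟩
  rwa [CFC.sqrt_mul_sqrt_self _ (CFC.abs_nonneg A)]

theorem tsum_norm_sq_comp_ne_top (R W : H →L[ℂ] H)
    (hR : ∑' i, ENNReal.ofReal (‖R (onb H i)‖ ^ 2) ≠ ∞) :
    ∑' i, ENNReal.ofReal (‖(W * R) (onb H i)‖ ^ 2) ≠ ∞ := by
  refine ne_top_of_le_ne_top (ENNReal.mul_ne_top (ENNReal.ofReal_ne_top (r := ‖W‖ ^ 2)) hR) ?_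
  rw [← ENNReal.tsum_mul_left]
  refine ENNReal.tsum_le_tsum fun i => ?_
  rw [← ENNReal.ofReal_mul (by positivity), ← mul_pow]
  gcongr
  exact W.le_opNorm _

theorem trace_mul_comm {S : H →L[ℂ] H} (hS : S ∈ traceClass H) (X : H →L[ℂ] H) :
    trace (S * X) = trace (X * S) := by
  obtain ⟨V, R, hV, hR, rfl, hsum⟩ := exists_factorization S
  have hfin : ∑' i, ENNReal.ofReal (‖R (onb H i)‖ ^ 2) ≠ ∞ := hsum ▸ ne_of_lt hS
  have adj : ∀ Y Z : H →L[ℂ] H, (Y * Z).adjoint = Z.adjoint * Y.adjoint :=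
    fun Y Z => ContinuousLinearMap.adjoint_comp Y Z
  have hfin' : ∀ W : H →L[ℂ] H, ∑' i, ENNReal.ofReal (‖(R * W) (onb H i)‖ ^ 2) ≠ ∞ := fun W => by
    rw [tsum_norm_sq_adjoint (onb H) (onb H), adj, hR]
    exact tsum_norm_sq_comp_ne_top R _ hfin
  have hsym : ∀ x y, ⟪R x, y⟫_ℂ = ⟪x, R y⟫_ℂ := fun x y => by
    rw [← ContinuousLinearMap.adjoint_inner_right, hR]
  have h1 := tsum_inner_swap (onb H) (onb H) (R * V.adjoint) (R * X) (hfin' _) (hfin' _)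
  have h2 := tsum_inner_swap (onb H) (onb H) (R * (X * V).adjoint) R (hfin' _) hfin
  calc trace (V * (R * R) * X)
      = ∑' i, ⟪(R * V.adjoint) (onb H i), (R * X) (onb H i)⟫_ℂ := by
        refine tsum_congr fun i => ?_
        simp only [mul_apply_eq_comp]
        rw [← ContinuousLinearMap.adjoint_inner_left, ← ContinuousLinearMap.adjoint_inner_left R,
          hR]
    _ = ∑' i, ⟪(R * X).adjoint (onb H i), (R * V.adjoint).adjoint (onb H i)⟫_ℂ := h1
    _ = ∑' i, ⟪R.adjoint (onb H i), (R * (X * V).adjoint).adjoint (onb H i)⟫_ℂ := by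
        refine tsum_congr fun i => ?_
        simp only [adj, hR, mul_apply_eq_comp, ContinuousLinearMap.adjoint_adjoint,
          ContinuousLinearMap.adjoint_inner_left]
    _ = ∑' i, ⟪(R * (X * V).adjoint) (onb H i), R (onb H i)⟫_ℂ := h2.symm
    _ = trace (X * (V * (R * R))) := by
        refine tsum_congr fun i => ?_
        simp only [mul_apply_eq_comp, adj]
        rw [hsym, ContinuousLinearMap.adjoint_inner_left, ContinuousLinearMap.adjoint_inner_left]

theorem norm_trace_mul_le (X : H →L[ℂ] H) {S : H →L[ℂ] H} (hS : S ∈ traceClass H) :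
    ‖trace (X * S)‖ ≤ ‖X‖ * (traceNorm S).toReal := by
  refine (norm_trace_le (mul_mem_traceClass X hS)).trans ?_
  have := ENNReal.toReal_mono (ENNReal.mul_ne_top ENNReal.ofReal_ne_top (ne_of_lt hS))
    (traceNorm_mul_le X S)
  rwa [ENNReal.toReal_mul, ENNReal.toReal_ofReal (norm_nonneg _)] at this

omit [CompleteSpace H] in
theorem rankOne_self_nonneg (x : H) : 0 ≤ rankOne ℂ x x :=
  (ContinuousLinearMap.nonneg_iff_isPositive _).2 (isPositive_rankOne_self x)

theorem traceNorm_rankOne_self (x : H) :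
    traceNorm (rankOne ℂ x x) = ENNReal.ofReal (‖x‖ ^ 2) := by
  rw [traceNorm, traceNormIn, CFC.abs_of_nonneg _ (rankOne_self_nonneg x),
    ← tsum_enorm_inner_sq (onb H) x]
  refine tsum_congr fun i => ?_
  rw [inner_right_rankOne_apply, ← inner_conj_symm x, RCLike.mul_conj]
  norm_cast

theorem traceNorm_rankOne_le (x y : H) :
    traceNorm (rankOne ℂ x y) ≤ ENNReal.ofReal (‖x‖ * ‖y‖) := by
  rcases eq_or_ne y 0 with rfl | hy
  · simp [traceNorm, traceNormIn]
  · have hn : ⟪y, y⟫_ℂ ≠ 0 := inner_self_ne_zero.2 hy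
    have h : rankOne ℂ x y = (⟪y, y⟫_ℂ)⁻¹ • (rankOne ℂ x y * rankOne ℂ y y) := by
      rw [ContinuousLinearMap.mul_def, rankOne_comp_rankOne, smul_smul, inv_mul_cancel₀ hn,
        one_smul]
    have h2 : ‖(⟪y, y⟫_ℂ)⁻¹‖ * (‖x‖ * ‖y‖ * ‖y‖ ^ 2) = ‖x‖ * ‖y‖ := by
      have := norm_ne_zero_iff.2 hy
      rw [inner_self_eq_norm_sq_to_K, norm_inv, norm_pow, RCLike.norm_ofReal, abs_norm]
      field_simp
    rw [h, traceNorm_smul, ← h2, ENNReal.ofReal_mul (norm_nonneg _),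
      ENNReal.ofReal_mul (by positivity), ← traceNorm_rankOne_self, ← norm_rankOne (𝕜 := ℂ)]
    gcongr
    exact traceNorm_mul_le _ _

theorem rankOne_mem_traceClass (x y : H) : rankOne ℂ x y ∈ traceClass H :=
  (traceNorm_rankOne_le x y).trans_lt ENNReal.ofReal_lt_top

/-- The rank one operator `z ↦ ⟨y, z⟩ x` as a trace class operator. -/
noncomputable def ketBra (x y : H) : traceClass H := ⟨rankOne ℂ x y, rankOne_mem_traceClass x y⟩

@[simp] theorem coe_ketBra (x y : H) : (ketBra x y : H →L[ℂ] H) = rankOne ℂ x y := rfl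

theorem ketBra_add_left (x x' y : H) : ketBra (x + x') y = ketBra x y + ketBra x' y :=
  Subtype.ext (by simp)

theorem ketBra_add_right (x y y' : H) : ketBra x (y + y') = ketBra x y + ketBra x y' :=
  Subtype.ext (by simp)

theorem ketBra_smul_left (c : ℂ) (x y : H) : ketBra (c • x) y = c • ketBra x y :=
  Subtype.ext (by simp)

theorem ketBra_smul_right (c : ℂ) (x y : H) :
    ketBra x (c • y) = (starRingEnd ℂ) c • ketBra x y :=
  Subtype.ext (by simp)

omit [CompleteSpace H] in
theorem mul_rankOne (X : H →L[ℂ] H) (x y : H) : X * rankOne ℂ x y = rankOne ℂ (X x) y :=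
  comp_rankOne x y X

theorem trace_rankOne (x y : H) : trace (rankOne ℂ x y) = ⟪y, x⟫_ℂ := by
  rw [← (onb H).tsum_inner_mul_inner y x]
  refine tsum_congr fun i => ?_
  rw [inner_right_rankOne_apply, mul_comm]

theorem trace_mul_rankOne (X : H →L[ℂ] H) (x y : H) :
    trace (X * rankOne ℂ x y) = ⟪y, X x⟫_ℂ := by
  rw [mul_rankOne, trace_rankOne]

theorem trace_rankOne_mul (X : H →L[ℂ] H) (x y : H) :
    trace (rankOne ℂ x y * X) = ⟪y, X x⟫_ℂ := by
  rw [trace_mul_comm (rankOne_mem_traceClass x y), trace_mul_rankOne]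

/-- Boundedness of a linear functional on the trace class for the trace norm. -/
def IsTraceNormBounded (φ : traceClass H →ₗ[ℂ] ℂ) : Prop :=
  ∃ C : ℝ, ∀ S : traceClass H, ‖φ S‖ ≤ C * (traceNorm (S : H →L[ℂ] H)).toReal

theorem IsTraceNormBounded.comp_leftMul {φ : traceClass H →ₗ[ℂ] ℂ} (hφ : IsTraceNormBounded φ)
    (X : H →L[ℂ] H) : IsTraceNormBounded (φ ∘ₗ leftMul X) := by
  obtain ⟨C, hC⟩ := hφ
  refine ⟨|C| * ‖X‖, fun S => (hC (leftMul X S)).trans ?_⟩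
  have := ENNReal.toReal_mono (ENNReal.mul_ne_top ENNReal.ofReal_ne_top (traceNorm_ne_top S))
    (traceNorm_mul_le X S)
  rw [ENNReal.toReal_mul, ENNReal.toReal_ofReal (norm_nonneg _)] at this
  rw [mul_assoc]
  exact mul_le_mul (le_abs_self C) this ENNReal.toReal_nonneg (abs_nonneg C)

theorem isTraceNormBounded_trace_mul (X : H →L[ℂ] H) :
    IsTraceNormBounded (traceLin ∘ₗ leftMul X) :=
  IsTraceNormBounded.comp_leftMul ⟨1, fun S => by simpa using norm_trace_le S.2⟩ X

theorem IsTraceNormBounded.sub {φ ψ : traceClass H →ₗ[ℂ] ℂ} (hφ : IsTraceNormBounded φ)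
    (hψ : IsTraceNormBounded ψ) : IsTraceNormBounded (φ - ψ) := by
  obtain ⟨C, hC⟩ := hφ
  obtain ⟨D, hD⟩ := hψ
  refine ⟨C + D, fun S => (norm_sub_le _ _).trans ?_⟩
  rw [add_mul]
  exact add_le_add (hC S) (hD S)

/-- A positive trace class operator `R²` is the trace norm convergent sum of the rank one operators
`|R bᵢ⟩⟨R bᵢ|`: the remainders are positive, so that their trace norm is their trace. -/
theorem IsTraceNormBounded.hasSum_of_sq {φ : traceClass H →ₗ[ℂ] ℂ} (hφ : IsTraceNormBounded φ)
    {R : H →L[ℂ] H} (hR : R.adjoint = R) (hRR : R * R ∈ traceClass H) :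
    HasSum (fun i => φ (ketBra (R (onb H i)) (R (onb H i)))) (φ ⟨R * R, hRR⟩) := by
  obtain ⟨C, hC⟩ := hφ
  set r : basisIndex H → traceClass H := fun i => ketBra (R (onb H i)) (R (onb H i)) with hr
  have hpos : ∀ F : Finset (basisIndex H),
      0 ≤ ((⟨R * R, hRR⟩ - ∑ i ∈ F, r i : traceClass H) : H →L[ℂ] H) := fun F => by
    rw [ContinuousLinearMap.nonneg_iff_isPositive, ContinuousLinearMap.isPositive_iff_complex]
    intro x
    have hb := (onb H).orthonormal.sum_inner_products_le (R x) (s := F)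
    have hval : ⟪((⟨R * R, hRR⟩ - ∑ i ∈ F, r i : traceClass H) : H →L[ℂ] H) x, x⟫_ℂ =
        ((‖R x‖ ^ 2 - ∑ i ∈ F, ‖⟪onb H i, R x⟫_ℂ‖ ^ 2 : ℝ) : ℂ) := by
      rw [AddSubgroupClass.coe_sub, AddSubmonoidClass.coe_finsetSum, sub_apply, inner_sub_left]
      simp only [hr, coe_ketBra, mul_apply_eq_comp, sum_apply, sum_inner]
      push_cast
      congr 1
      · rw [← ContinuousLinearMap.adjoint_inner_right, hR, inner_self_eq_norm_sq_to_K]; norm_cast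
      · refine Finset.sum_congr rfl fun i _ => ?_
        rw [inner_left_rankOne_apply, ← hR, ContinuousLinearMap.adjoint_inner_left,
          ContinuousLinearMap.adjoint_inner_right, hR, ← inner_conj_symm (R x), RCLike.conj_mul]
        norm_cast
    rw [hval]
    exact ⟨rfl, sub_nonneg.2 hb⟩
  have htr : ∀ F : Finset (basisIndex H),
      ((traceNorm ((⟨R * R, hRR⟩ - ∑ i ∈ F, r i : traceClass H) : H →L[ℂ] H)).toReal : ℂ) =
        trace (R * R) - ∑ i ∈ F, ⟪onb H i, (R * R) (onb H i)⟫_ℂ := fun F => by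
    rw [← trace_of_nonneg (hpos F), ← traceLin_apply, map_sub, map_sum]
    congr 1
    refine Finset.sum_congr rfl fun i _ => ?_
    simp only [hr, traceLin_apply, coe_ketBra, trace_rankOne, mul_apply_eq_comp]
    conv_lhs => rw [← hR, ContinuousLinearMap.adjoint_inner_left, hR]
  have hlim : Filter.Tendsto (fun F : Finset (basisIndex H) =>
      (traceNorm ((⟨R * R, hRR⟩ - ∑ i ∈ F, r i : traceClass H) : H →L[ℂ] H)).toReal)
      Filter.atTop (𝓝 0) := by
    have h1 : Filter.Tendsto (fun F : Finset (basisIndex H) =>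
        trace (R * R) - ∑ i ∈ F, ⟪onb H i, (R * R) (onb H i)⟫_ℂ) Filter.atTop
        (𝓝 (trace (R * R) - trace (R * R))) :=
      tendsto_const_nhds.sub (summable_norm_inner hRR).of_norm.hasSum
    rw [sub_self] at h1
    simp only [← htr] at h1
    exact (Complex.continuous_re.tendsto 0).comp h1
  refine tendsto_iff_norm_sub_tendsto_zero.2 ?_
  refine squeeze_zero (fun _ => norm_nonneg _) (fun F => ?_) (mul_zero C ▸ hlim.const_mul C)
  rw [norm_sub_rev, ← map_sum, ← map_sub]
  exact hC _

/-- The expansion `S = ∑ |V R bᵢ⟩⟨R bᵢ|` of `S = V R²`, tested against bounded functionals. -/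
theorem IsTraceNormBounded.hasSum {φ : traceClass H →ₗ[ℂ] ℂ} (hφ : IsTraceNormBounded φ)
    {V R : H →L[ℂ] H} (hR : R.adjoint = R) (hRR : R * R ∈ traceClass H) {S : traceClass H}
    (hS : (S : H →L[ℂ] H) = V * (R * R)) :
    HasSum (fun i => φ (ketBra (V (R (onb H i))) (R (onb H i)))) (φ S) := by
  have h := (hφ.comp_leftMul V).hasSum_of_sq hR hRR
  have h1 : leftMul V ⟨R * R, hRR⟩ = S := Subtype.ext hS.symm
  have h2 : ∀ i, leftMul V (ketBra (R (onb H i)) (R (onb H i))) =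
      ketBra (V (R (onb H i))) (R (onb H i)) := fun i => Subtype.ext (mul_rankOne _ _ _)
  simpa only [LinearMap.comp_apply, h1, h2] using h

theorem sq_mem_traceClass {R : H →L[ℂ] H} (hR : R.adjoint = R)
    (hfin : ∑' i, ENNReal.ofReal (‖R (onb H i)‖ ^ 2) ≠ ∞) : R * R ∈ traceClass H := by
  have h0 : 0 ≤ R * R := by
    have := star_mul_self_nonneg R
    rwa [ContinuousLinearMap.star_eq_adjoint, hR] at this
  change traceNorm _ < ∞
  rw [traceNorm, traceNormIn, CFC.abs_of_nonneg _ h0]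
  convert! lt_top_iff_ne_top.2 hfin using 4 with i
  rw [mul_apply_eq_comp, ← ContinuousLinearMap.adjoint_inner_left, hR, inner_self_eq_norm_sq_to_K]
  norm_cast

/-- A bounded functional on the trace class is determined by its values on the operators
`|x⟩⟨x|`, by polarization and the expansion of a trace class operator. -/
theorem IsTraceNormBounded.eq_zero {φ : traceClass H →ₗ[ℂ] ℂ} (hφ : IsTraceNormBounded φ)
    (h : ∀ x, φ (ketBra x x) = 0) : φ = 0 := by
  have hxy : ∀ x y, φ (ketBra x y) = 0 := fun x y => by
    have h1 := h (x + y)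
    have h2 := h (x + Complex.I • y)
    rw [ketBra_add_left, ketBra_add_right, ketBra_add_right, map_add, map_add, map_add, h, h,
      zero_add, add_zero] at h1
    rw [ketBra_add_left, ketBra_add_right, ketBra_add_right, map_add, map_add, map_add, h, h,
      zero_add, add_zero, ketBra_smul_left, ketBra_smul_right, map_smul, map_smul, smul_eq_mul,
      smul_eq_mul, Complex.conj_I] at h2
    have h3 : Complex.I * (φ (ketBra y x) - φ (ketBra x y)) = 0 := by linear_combination h2
    have h4 := (mul_eq_zero.1 h3).resolve_left Complex.I_ne_zero
    linear_combination (1 / 2 : ℂ) * h1 - (1 / 2 : ℂ) * h4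
  refine LinearMap.ext fun S => ?_
  obtain ⟨V, R, -, hR, hS, hsum⟩ := exists_factorization (S : H →L[ℂ] H)
  have := hφ.hasSum hR (sq_mem_traceClass hR (hsum ▸ traceNorm_ne_top S)) hS
  simp only [hxy] at this
  exact (this.unique hasSum_zero)

theorem trace_mul_add {S : H →L[ℂ] H} (hS : S ∈ traceClass H) (A B : H →L[ℂ] H) :
    trace (S * (A + B)) = trace (S * A) + trace (S * B) := by
  rw [trace_mul_comm hS, trace_mul_comm hS, trace_mul_comm hS, add_mul]
  exact traceLin.map_add (leftMul A ⟨S, hS⟩) (leftMul B ⟨S, hS⟩)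

theorem trace_mul_smul (S : H →L[ℂ] H) (c : ℂ) (A : H →L[ℂ] H) :
    trace (S * (c • A)) = c * trace (S * A) := by
  rw [mul_smul_comm, trace_smul]

theorem eq_of_forall_trace_mul_eq {A B : H →L[ℂ] H}
    (h : ∀ S : traceClass H, trace ((S : H →L[ℂ] H) * A) = trace ((S : H →L[ℂ] H) * B)) :
    A = B := by
  refine ContinuousLinearMap.ext fun w => ext_inner_left ℂ fun u => ?_
  simpa only [coe_ketBra, trace_rankOne_mul] using h (ketBra w u)

/-- The bounded operators are the dual of the trace class: a trace norm bounded functional `φ` is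
represented by the operator of the bounded sesquilinear form `(u, w) ↦ φ (|w⟩⟨u|)`. -/
theorem IsTraceNormBounded.exists_eq_trace_mul {φ : traceClass H →ₗ[ℂ] ℂ}
    (hφ : IsTraceNormBounded φ) :
    ∃ A : H →L[ℂ] H, ∀ S : traceClass H, φ S = trace ((S : H →L[ℂ] H) * A) := by
  obtain ⟨C, hC⟩ := id hφ
  let B : H →ₗ⋆[ℂ] H →ₗ[ℂ] ℂ := LinearMap.mk₂'ₛₗ (starRingEnd ℂ) (RingHom.id ℂ)
    (fun u w => φ (ketBra w u)) (fun u u' w => by rw [ketBra_add_right, map_add])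
    (fun c u w => by rw [ketBra_smul_right, map_smul])
    (fun u w w' => by rw [ketBra_add_left, map_add])
    (fun c u w => by rw [ketBra_smul_left, map_smul]; rfl)
  let B' : H →L⋆[ℂ] H →L[ℂ] ℂ := B.mkContinuous₂ |C| fun u w => by
    refine (hC (ketBra w u)).trans ?_
    rw [mul_assoc, mul_comm ‖u‖]
    exact mul_le_mul (le_abs_self C) (ENNReal.toReal_le_of_le_ofReal (by positivity)
      (traceNorm_rankOne_le w u)) ENNReal.toReal_nonneg (abs_nonneg C)
  let A : H →L[ℂ] H := (continuousLinearMapOfBilin B').adjoint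
  have hA : ∀ u w, ⟪u, A w⟫_ℂ = φ (ketBra w u) := fun u w => by
    rw [ContinuousLinearMap.adjoint_inner_right, continuousLinearMapOfBilin_apply]
    rfl
  have hbd : IsTraceNormBounded (φ - traceLin ∘ₗ leftMul A) :=
    hφ.sub (isTraceNormBounded_trace_mul A)
  have h0 := hbd.eq_zero fun x => by
    rw [LinearMap.sub_apply, LinearMap.comp_apply, traceLin_apply, coe_leftMul, coe_ketBra,
      trace_mul_rankOne, hA, sub_self]
  refine ⟨A, fun S => ?_⟩
  rw [trace_mul_comm S.2]
  exact sub_eq_zero.1 (LinearMap.congr_fun h0 S)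

end TraceIdeal

/-! ### Pure states and their transition probabilities -/

section PureStates

variable {H : Type*} [NormedAddCommGroup H] [InnerProductSpace ℂ H] [CompleteSpace H]

/-- Operators `|x⟩⟨x|` are minimal: a positive operator below `|x⟩⟨x|` vanishes on the orthogonal
complement of `x`, hence is a multiple of `|x⟩⟨x|`. -/
theorem exists_smul_of_le_rankOne {S : H →L[ℂ] H} {x : H} (h0 : 0 ≤ S)
    (hS : S ≤ rankOne ℂ x x) : ∃ c : ℂ, S = c • rankOne ℂ x x := by
  rcases eq_or_ne x 0 with rfl | hx
  · exact ⟨0, by simpa using le_antisymm (by simpa using hS) h0⟩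
  have hn : ⟪x, x⟫_ℂ ≠ 0 := inner_self_ne_zero.2 hx
  have hsym : ∀ y z, ⟪S y, z⟫_ℂ = ⟪y, S z⟫_ℂ :=
    ((ContinuousLinearMap.nonneg_iff_isPositive S).1 h0).isSymmetric
  have hker : ∀ y, ⟪x, y⟫_ℂ = 0 → S y = 0 := fun y hy => by
    have h1 := ((ContinuousLinearMap.le_def _ _).1 hS).re_inner_nonneg_right y
    rw [sub_apply, inner_sub_right, rankOne_apply, hy, zero_smul, inner_zero_right, zero_sub,
      map_neg] at h1
    have h2 := re_inner_eq_norm_sqrt_sq h0 y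
    have h3 : ‖CFC.sqrt S y‖ ^ 2 ≤ 0 := by rw [← h2]; simpa using h1
    have h4 : CFC.sqrt S y = 0 := by
      rw [← norm_eq_zero]; exact pow_eq_zero_iff two_ne_zero |>.1 (le_antisymm h3 (by positivity))
    rw [← CFC.sqrt_mul_sqrt_self S h0, mul_apply_eq_comp, h4, map_zero]
  have hSx : S x = (⟪x, S x⟫_ℂ / ⟪x, x⟫_ℂ) • x := by
    rw [← sub_eq_zero]
    set w := S x - (⟪x, S x⟫_ℂ / ⟪x, x⟫_ℂ) • x with hw
    have hxw : ⟪x, w⟫_ℂ = 0 := by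
      rw [hw, inner_sub_right, inner_smul_right, div_mul_cancel₀ _ hn, sub_self]
    have hwx : ⟪w, x⟫_ℂ = 0 := inner_eq_zero_symm.1 hxw
    have : ⟪w, w⟫_ℂ = 0 := by
      conv_lhs => rw [hw]
      rw [← hw, inner_sub_right, inner_smul_right, hwx, mul_zero, sub_zero, ← hsym, hker w hxw,
        inner_zero_left]
    exact inner_self_eq_zero.1 this
  refine ⟨⟪x, S x⟫_ℂ / ⟪x, x⟫_ℂ / ⟪x, x⟫_ℂ, ContinuousLinearMap.ext fun z => ?_⟩
  have hz : S (z - (⟪x, z⟫_ℂ / ⟪x, x⟫_ℂ) • x) = 0 := hker _ (by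
    rw [inner_sub_right, inner_smul_right, div_mul_cancel₀ _ hn, sub_self])
  rw [map_sub, map_smul, sub_eq_zero, hSx, smul_smul] at hz
  rw [hz, smul_apply, rankOne_apply, smul_smul]
  congr 1
  ring

/-- A positive operator is of the form `|w⟩⟨w|` as soon as it is minimal: otherwise
`|√T v⟩⟨√T v| ≤ T`, for a unit vector `v`, would not be a multiple of `T`. -/
theorem exists_eq_rankOne_of_minimal {T : H →L[ℂ] H} (h0 : 0 ≤ T)
    (hmin : ∀ S ∈ traceClass H, 0 ≤ S → S ≤ T → ∃ c : ℂ, S = c • T) :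
    ∃ w : H, T = rankOne ℂ w w := by
  rcases eq_or_ne T 0 with rfl | hT
  · exact ⟨0, by simp⟩
  set R := CFC.sqrt T with hRdef
  have hR : R.adjoint = R := (CFC.sqrt_nonneg T).isSelfAdjoint
  have hRR : R * R = T := CFC.sqrt_mul_sqrt_self T h0
  obtain ⟨v, hv⟩ : ∃ v, R v ≠ 0 := by
    by_contra! h
    exact hT (by rw [← hRR, show R = 0 from ContinuousLinearMap.ext h, mul_zero])
  have hv0 : v ≠ 0 := fun h => hv (by rw [h, map_zero])
  set e : H := (‖v‖⁻¹ : ℂ) • v with he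
  have he1 : ‖e‖ = 1 := norm_smul_inv_norm hv0
  set y := R e with hy
  have hy0 : y ≠ 0 := by
    rw [hy, he, map_smul]
    exact smul_ne_zero (by simpa using hv0) hv
  have hle : rankOne ℂ y y ≤ T := by
    rw [ContinuousLinearMap.le_def, ContinuousLinearMap.isPositive_iff_complex]
    intro z
    have hval : ⟪(T - rankOne ℂ y y) z, z⟫_ℂ = ((‖R z‖ ^ 2 - ‖⟪e, R z⟫_ℂ‖ ^ 2 : ℝ) : ℂ) := by
      rw [sub_apply, inner_sub_left, inner_left_rankOne_apply, ← hRR, mul_apply_eq_comp,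
        ← ContinuousLinearMap.adjoint_inner_right, hR, inner_self_eq_norm_sq_to_K,
        ← inner_conj_symm z y, RCLike.conj_mul, hy, ← ContinuousLinearMap.adjoint_inner_right, hR]
      norm_cast
    rw [hval]
    refine ⟨rfl, ?_⟩
    have h1 : ‖⟪e, R z⟫_ℂ‖ ≤ ‖R z‖ := by simpa [he1] using norm_inner_le_norm (𝕜 := ℂ) e (R z)
    have h2 : ‖⟪e, R z⟫_ℂ‖ ^ 2 ≤ ‖R z‖ ^ 2 := by gcongr
    exact sub_nonneg.2 h2
  obtain ⟨c, hc⟩ := hmin _ (rankOne_mem_traceClass y y) (rankOne_self_nonneg y) hle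
  have hc0 : c ≠ 0 := by
    rintro rfl
    rw [zero_smul] at hc
    exact rankOne_ne_zero (𝕜 := ℂ) hy0 hy0 hc
  have hTc : T = c⁻¹ • rankOne ℂ y y := by rw [hc, smul_smul, inv_mul_cancel₀ hc0, one_smul]
  -- The scalar is `⟪y, T y⟫ / ⟪y, y⟫² = ‖R y‖² / ‖y‖⁴`, a nonnegative real.
  obtain ⟨r, hr, hrc⟩ : ∃ r : ℝ, 0 ≤ r ∧ (r : ℂ) = c⁻¹ := by
    refine ⟨‖R y‖ ^ 2 / (‖y‖ ^ 2 * ‖y‖ ^ 2), by positivity, ?_⟩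
    have h1 : ⟪y, T y⟫_ℂ = ((‖R y‖ ^ 2 : ℝ) : ℂ) := by
      rw [← hRR, mul_apply_eq_comp, ← ContinuousLinearMap.adjoint_inner_left, hR,
        inner_self_eq_norm_sq_to_K]
      norm_cast
    rw [hTc, smul_apply, inner_smul_right, inner_right_rankOne_apply,
      inner_self_eq_norm_sq_to_K] at h1
    have hn : (‖y‖ : ℂ) ≠ 0 := by exact_mod_cast norm_ne_zero_iff.2 hy0
    push_cast at h1 ⊢
    rw [← h1]
    change _ * ((‖y‖ : ℂ) ^ 2 * (‖y‖ : ℂ) ^ 2) / _ = _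
    field_simp
  refine ⟨(Real.sqrt r : ℂ) • y, ?_⟩
  rw [hTc, ← hrc]
  ext z
  simp only [smul_apply, map_smul, rankOne_apply, ContinuousLinearMap.map_smulₛₗ,
    smul_smul, Complex.conj_ofReal]
  congr 1
  have : (Real.sqrt r : ℂ) * Real.sqrt r = r := by exact_mod_cast Real.mul_self_sqrt hr
  rw [← this]

/-- The difference `A` of two pure states satisfies `A³ = s² A` with `s² = 1 - |⟨x, y⟩|²`, so that
`|A| = A² / s`. -/
theorem traceNorm_sub_rankOne {x y : H} (hx : ‖x‖ = 1) (hy : ‖y‖ = 1) :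
    traceNorm (rankOne ℂ x x - rankOne ℂ y y) =
      ENNReal.ofReal (2 * Real.sqrt (1 - ‖⟪x, y⟫_ℂ‖ ^ 2)) := by
  set P := rankOne ℂ x x with hP
  set Q := rankOne ℂ y y with hQ
  set t : ℝ := 1 - ‖⟪x, y⟫_ℂ‖ ^ 2 with ht
  set A := P - Q with hA
  have hxx : ⟪x, x⟫_ℂ = 1 := by rw [inner_self_eq_norm_sq_to_K, hx]; simp
  have hyy : ⟪y, y⟫_ℂ = 1 := by rw [inner_self_eq_norm_sq_to_K, hy]; simp
  have hc : ⟪x, y⟫_ℂ * ⟪y, x⟫_ℂ = 1 - (t : ℂ) := by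
    rw [← inner_conj_symm y x, Complex.mul_conj', ht]; push_cast; ring
  have ht0 : 0 ≤ t := by
    have : ‖⟪x, y⟫_ℂ‖ ≤ 1 := by simpa [hx, hy] using norm_inner_le_norm (𝕜 := ℂ) x y
    rw [ht]
    nlinarith [norm_nonneg ⟪x, y⟫_ℂ]
  have hPP : P * P = P := by rw [hP, mul_rankOne, rankOne_apply, hxx, one_smul]
  have hQQ : Q * Q = Q := by rw [hQ, mul_rankOne, rankOne_apply, hyy, one_smul]
  have hPQP : P * Q * P = (1 - (t : ℂ)) • P := by
    rw [← hc, hP, hQ, mul_assoc, mul_rankOne, mul_rankOne, rankOne_apply, map_smul, rankOne_apply]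
    simp [mul_comm]
  have hQPQ : Q * P * Q = (1 - (t : ℂ)) • Q := by
    rw [← hc, hP, hQ, mul_assoc, mul_rankOne, mul_rankOne, rankOne_apply, map_smul, rankOne_apply]
    simp
  have hcube : A * A * A = (t : ℂ) • A := by
    have : A * A * A = P * P * P - P * P * Q - P * Q * P + P * (Q * Q) - Q * (P * P) + Q * P * Q
        + Q * Q * P - Q * Q * Q := by rw [hA]; noncomm_ring
    rw [this, hPQP, hQPQ, hPP, hQQ, hPP, hQQ, hA]
    module
  have hsa : star A = A := by
    have h1 : star P = P := (rankOne_self_nonneg x).isSelfAdjoint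
    have h2 : star Q = Q := (rankOne_self_nonneg y).isSelfAdjoint
    rw [hA, star_sub, h1, h2]
  have hAA : 0 ≤ A * A := by
    have := star_mul_self_nonneg A
    rwa [hsa] at this
  rcases ht0.eq_or_lt with h | h
  · -- In the degenerate case `A³ = 0`, hence `A = 0` since `A` is self-adjoint.
    rw [← h, Complex.ofReal_zero, zero_smul] at hcube
    have h4 : A * A = 0 := by
      rw [← CStarRing.star_mul_self_eq_zero_iff, star_mul, hsa, ← mul_assoc, hcube, zero_mul]
    have h5 : A = 0 := by
      rw [← CStarRing.star_mul_self_eq_zero_iff, hsa, h4]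
    rw [h5, ← h]
    simp [traceNorm, traceNormIn]
  · have hs : 0 < Real.sqrt t := Real.sqrt_pos.2 h
    have hss : (Real.sqrt t : ℂ) * Real.sqrt t = t := by exact_mod_cast Real.mul_self_sqrt ht0
    have hs0 : (Real.sqrt t : ℂ) ≠ 0 := by exact_mod_cast hs.ne'
    have habs : CFC.abs A = ((Real.sqrt t : ℂ)⁻¹) • (A * A) := by
      refine CFC.sqrt_unique ?_ (smul_nonneg ?_ hAA)
      · rw [hsa, smul_mul_smul_comm, ← mul_assoc, hcube, smul_mul_assoc, smul_smul, ← hss]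
        rw [show (Real.sqrt t : ℂ)⁻¹ * (Real.sqrt t : ℂ)⁻¹ * (Real.sqrt t * Real.sqrt t) = 1 by
          field_simp, one_smul]
      · rw [← Complex.ofReal_inv]
        exact_mod_cast (inv_pos.2 hs).le
    have hmem : A ∈ traceClass H :=
      sub_mem (rankOne_mem_traceClass x x) (rankOne_mem_traceClass y y)
    have htrace : trace (CFC.abs A) = ((2 * Real.sqrt t : ℝ) : ℂ) := by
      have h1 : A * A = ((ketBra x x + ketBra y y - leftMul P (ketBra y y) -
          leftMul Q (ketBra x x) : traceClass H) : H →L[ℂ] H) := by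
        simp only [AddSubgroupClass.coe_sub, Submodule.coe_add, coe_leftMul, coe_ketBra]
        rw [← hP, ← hQ, hA]
        calc (P - Q) * (P - Q) = P * P + Q * Q - P * Q - Q * P := by noncomm_ring
          _ = _ := by rw [hPP, hQQ]
      rw [habs, trace_smul, h1, ← traceLin_apply, map_sub, map_sub, map_add]
      simp only [traceLin_apply, coe_leftMul, coe_ketBra, trace_rankOne, trace_mul_rankOne,
        hP, hQ, inner_right_rankOne_apply, hxx, hyy]
      rw [mul_comm ⟪y, x⟫_ℂ, hc, ← hss]
      push_cast
      field_simp
      ring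
    have h2 := trace_of_nonneg (CFC.abs_nonneg A)
    have h3 : traceNorm (CFC.abs A) = traceNorm A := by
      rw [traceNorm, traceNorm, traceNormIn, traceNormIn, CFC.cfcAbs_cfcAbs]
    rw [htrace, h3] at h2
    rw [← ENNReal.ofReal_toReal (ne_of_lt hmem)]
    congr 1
    exact_mod_cast h2.symm

theorem ketBra_smul_self (c : ℂ) (x : H) :
    ketBra (c • x) (c • x) = ((‖c‖ ^ 2 : ℝ) : ℂ) • ketBra x x := by
  refine Subtype.ext (ContinuousLinearMap.ext fun z => ?_)
  simp only [coe_ketBra, rankOne_apply, inner_smul_left, smul_smul, Submodule.coe_smul, smul_apply]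
  congr 1
  push_cast
  rw [← Complex.conj_mul']
  ring

theorem trace_ketBra_mul_self (x y : H) :
    trace ((ketBra x x : H →L[ℂ] H) * (ketBra y y : H →L[ℂ] H)) = ((‖⟪x, y⟫_ℂ‖ ^ 2 : ℝ) : ℂ) := by
  rw [coe_ketBra, coe_ketBra, trace_mul_rankOne, inner_right_rankOne_apply, ← inner_conj_symm y x,
    RCLike.conj_mul]
  norm_cast

end PureStates

section Automorphisms

variable {H : Type*} [NormedAddCommGroup H] [InnerProductSpace ℂ H] [CompleteSpace H]
  {u : traceClass H ≃ₗ[ℂ] traceClass H}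

/-- An order automorphism of the trace class which preserves the trace norm maps pure states to pure
states, since these are characterized by minimality. -/
theorem exists_map_ketBra_self
    (hpos : ∀ S : traceClass H, (S : H →L[ℂ] H).IsPositive → (u S : H →L[ℂ] H).IsPositive)
    (hpos' : ∀ S : traceClass H, (S : H →L[ℂ] H).IsPositive → (u.symm S : H →L[ℂ] H).IsPositive)
    (hnorm : ∀ S : traceClass H, traceNorm (u S : H →L[ℂ] H) = traceNorm (S : H →L[ℂ] H))
    (x : H) : ∃ w : H, ‖w‖ = ‖x‖ ∧ u (ketBra x x) = ketBra w w := by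
  have h0 : 0 ≤ (u (ketBra x x) : H →L[ℂ] H) :=
    (ContinuousLinearMap.nonneg_iff_isPositive _).2 (hpos _ (isPositive_rankOne_self x))
  obtain ⟨w, hw⟩ := exists_eq_rankOne_of_minimal h0 (fun S hS hS0 hSle => by
    obtain ⟨c, hc⟩ := exists_smul_of_le_rankOne (S := u.symm ⟨S, hS⟩) (x := x)
      ((ContinuousLinearMap.nonneg_iff_isPositive _).2
        (hpos' ⟨S, hS⟩ ((ContinuousLinearMap.nonneg_iff_isPositive _).1 hS0)))
      (by
        have := hpos' (u (ketBra x x) - ⟨S, hS⟩) hSle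
        rwa [map_sub, u.symm_apply_apply] at this)
    have h1 : u.symm ⟨S, hS⟩ = c • ketBra x x := Subtype.ext hc
    have h2 : (⟨S, hS⟩ : traceClass H) = c • u (ketBra x x) := by
      rw [← map_smul, ← h1, u.apply_symm_apply]
    exact ⟨c, congrArg Subtype.val h2⟩)
  refine ⟨w, ?_, Subtype.ext hw⟩
  have h1 := hnorm (ketBra x x)
  rw [hw, coe_ketBra, traceNorm_rankOne_self, traceNorm_rankOne_self,
    ENNReal.ofReal_eq_ofReal_iff (by positivity) (by positivity)] at h1
  exact (sq_eq_sq₀ (norm_nonneg _) (norm_nonneg _)).1 h1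

/-- Transition probabilities are preserved, as they are encoded in trace norm distances. -/
theorem trace_map_mul_map_ketBra
    (hpos : ∀ S : traceClass H, (S : H →L[ℂ] H).IsPositive → (u S : H →L[ℂ] H).IsPositive)
    (hpos' : ∀ S : traceClass H, (S : H →L[ℂ] H).IsPositive → (u.symm S : H →L[ℂ] H).IsPositive)
    (hnorm : ∀ S : traceClass H, traceNorm (u S : H →L[ℂ] H) = traceNorm (S : H →L[ℂ] H))
    (x y : H) :
    trace ((u (ketBra x x) : H →L[ℂ] H) * (u (ketBra y y) : H →L[ℂ] H)) =
      trace ((ketBra x x : H →L[ℂ] H) * (ketBra y y : H →L[ℂ] H)) := by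
  have unit : ∀ x y : H, ‖x‖ = 1 → ‖y‖ = 1 →
      trace ((u (ketBra x x) : H →L[ℂ] H) * (u (ketBra y y) : H →L[ℂ] H)) =
        trace ((ketBra x x : H →L[ℂ] H) * (ketBra y y : H →L[ℂ] H)) := fun x y hx hy => by
    obtain ⟨w, hw, hxw⟩ := exists_map_ketBra_self hpos hpos' hnorm x
    obtain ⟨z, hz, hyz⟩ := exists_map_ketBra_self hpos hpos' hnorm y
    rw [hx] at hw
    rw [hy] at hz
    have h := hnorm (ketBra x x - ketBra y y)
    rw [map_sub, hxw, hyz, AddSubgroupClass.coe_sub, AddSubgroupClass.coe_sub, coe_ketBra,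
      coe_ketBra, coe_ketBra, coe_ketBra, traceNorm_sub_rankOne hw hz, traceNorm_sub_rankOne hx hy,
      ENNReal.ofReal_eq_ofReal_iff (by positivity) (by positivity)] at h
    have le : ∀ a b : H, ‖a‖ = 1 → ‖b‖ = 1 → 0 ≤ 1 - ‖⟪a, b⟫_ℂ‖ ^ 2 := fun a b ha hb => by
      have : ‖⟪a, b⟫_ℂ‖ ≤ 1 := by simpa [ha, hb] using norm_inner_le_norm (𝕜 := ℂ) a b
      nlinarith [norm_nonneg ⟪a, b⟫_ℂ]
    have h' := (Real.sqrt_inj (le _ _ hw hz) (le _ _ hx hy)).1 (mul_left_cancel₀ two_ne_zero h)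
    rw [hxw, hyz, trace_ketBra_mul_self, trace_ketBra_mul_self]
    congr 1
    linarith
  have scale : ∀ x : H, ∃ (c : ℂ) (e : H), (c = 0 ∨ ‖e‖ = 1) ∧ ketBra x x = c • ketBra e e :=
    fun x => by
    rcases eq_or_ne x 0 with rfl | hx
    · exact ⟨0, 0, Or.inl rfl, Subtype.ext (by simp)⟩
    · refine ⟨((‖(‖x‖ : ℂ)‖ ^ 2 : ℝ) : ℂ), (‖x‖⁻¹ : ℂ) • x, Or.inr (norm_smul_inv_norm hx), ?_⟩
      rw [← ketBra_smul_self, smul_smul, mul_inv_cancel₀ (by simpa using hx), one_smul]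
  obtain ⟨c, e, hce, hx⟩ := scale x
  obtain ⟨k, f, hkf, hy⟩ := scale y
  simp only [hx, hy, map_smul, Submodule.coe_smul, smul_mul_smul_comm, trace_smul]
  rcases hce with rfl | he
  · simp
  rcases hkf with rfl | hf
  · simp
  rw [unit e f he hf]

theorem IsTraceNormBounded.comp_isometry {φ : traceClass H →ₗ[ℂ] ℂ} (hφ : IsTraceNormBounded φ)
    (hnorm : ∀ S : traceClass H, traceNorm (u S : H →L[ℂ] H) = traceNorm (S : H →L[ℂ] H)) :
    IsTraceNormBounded (φ ∘ₗ u.toLinearMap) := by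
  obtain ⟨C, hC⟩ := hφ
  exact ⟨C, fun S => (hC (u S)).trans_eq (by rw [hnorm])⟩

/-- Order automorphisms of the trace class preserving the trace norm also preserve the
Hilbert-Schmidt pairing `Tr (S T)`; this replaces Wigner's theorem. -/
theorem trace_map_mul_map
    (hpos : ∀ S : traceClass H, (S : H →L[ℂ] H).IsPositive → (u S : H →L[ℂ] H).IsPositive)
    (hpos' : ∀ S : traceClass H, (S : H →L[ℂ] H).IsPositive → (u.symm S : H →L[ℂ] H).IsPositive)
    (hnorm : ∀ S : traceClass H, traceNorm (u S : H →L[ℂ] H) = traceNorm (S : H →L[ℂ] H))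
    (S T : traceClass H) :
    trace ((u S : H →L[ℂ] H) * (u T : H →L[ℂ] H)) =
      trace ((S : H →L[ℂ] H) * (T : H →L[ℂ] H)) := by
  have key : ∀ S : traceClass H,
      (∀ y, trace ((u S : H →L[ℂ] H) * (u (ketBra y y) : H →L[ℂ] H)) =
        trace ((S : H →L[ℂ] H) * (ketBra y y : H →L[ℂ] H))) →
      ∀ T : traceClass H, trace ((u S : H →L[ℂ] H) * (u T : H →L[ℂ] H)) =
        trace ((S : H →L[ℂ] H) * (T : H →L[ℂ] H)) := fun S hS T =>
    sub_eq_zero.1 (LinearMap.congr_fun (((isTraceNormBounded_trace_mul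
      (u S : H →L[ℂ] H)).comp_isometry hnorm).sub (isTraceNormBounded_trace_mul
      (S : H →L[ℂ] H))|>.eq_zero fun y => sub_eq_zero.2 (hS y)) T)
  refine key S (fun y => ?_) T
  rw [trace_mul_comm (u S).2, trace_mul_comm S.2]
  exact key (ketBra y y) (trace_map_mul_map_ketBra hpos hpos' hnorm y) S

end Automorphisms

/-! ### Integration against operator densities -/

section ResolutionDensity

variable {H : Type*} [NormedAddCommGroup H] [InnerProductSpace ℂ H] [CompleteSpace H]

theorem countable_basisIndex [TopologicalSpace.SeparableSpace H] : Countable (basisIndex H) := by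
  have hdist : Pairwise fun i j => 1 ≤ dist (onb H i) (onb H j) := fun i j hij => by
    have h1 : ‖onb H i - onb H j‖ ^ 2 = 2 := by
      rw [norm_sub_sq (𝕜 := ℂ), (onb H).orthonormal.2 hij, (onb H).orthonormal.1,
        (onb H).orthonormal.1]
      norm_num
    change 1 ≤ dist _ _
    rw [dist_eq_norm]
    nlinarith [norm_nonneg (onb H i - onb H j)]
  refine Pairwise.countable_of_isOpen_disjoint (s := fun i => Metric.ball (onb H i) (1 / 2))
    (fun i j hij => Metric.ball_disjoint_ball (by linarith [hdist hij]))
    (fun _ => Metric.isOpen_ball) (fun i => Metric.nonempty_ball.2 (by norm_num))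

theorem norm_inner_le_of_isPositive {X : H →L[ℂ] H} (hX : X.IsPositive) (u w : H) :
    ‖⟪u, X w⟫_ℂ‖ ≤ 1 / 2 * (⟪u, X u⟫_ℂ).re + 1 / 2 * (⟪w, X w⟫_ℂ).re := by
  have h0 : 0 ≤ X := (ContinuousLinearMap.nonneg_iff_isPositive X).2 hX
  have hsq : (CFC.sqrt X).adjoint = CFC.sqrt X := (CFC.sqrt_nonneg X).isSelfAdjoint
  rw [re_inner_eq_norm_sqrt_sq h0, re_inner_eq_norm_sqrt_sq h0]
  conv_lhs => rw [← CFC.sqrt_mul_sqrt_self X h0]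
  rw [mul_apply_eq_comp, ← ContinuousLinearMap.adjoint_inner_left, hsq]
  refine (norm_inner_le_norm _ _).trans ?_
  nlinarith [sq_nonneg (‖CFC.sqrt X u‖ - ‖CFC.sqrt X w‖)]

variable {Ω : Type*} [MeasurableSpace Ω] {μ : Measure Ω}

/-- `X` is the density, with respect to `μ`, of a positive operator valued measure with total mass
the identity: a weakly measurable family of positive operators with `∫ X dμ = 1`. -/
structure IsResolutionDensity (μ : Measure Ω) (X : Ω → H →L[ℂ] H) : Prop where
  isPositive : ∀ x, (X x).IsPositive
  aestronglyMeasurable : ∀ S : traceClass H,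
    AEStronglyMeasurable (fun x => trace ((S : H →L[ℂ] H) * X x)) μ
  lintegral_inner : ∀ v, ∫⁻ x, ENNReal.ofReal (⟪v, X x v⟫_ℂ).re ∂μ = ENNReal.ofReal (‖v‖ ^ 2)

namespace IsResolutionDensity

variable {X : Ω → H →L[ℂ] H}

theorem aestronglyMeasurable_inner (hX : IsResolutionDensity μ X) (u w : H) :
    AEStronglyMeasurable (fun x => ⟪u, X x w⟫_ℂ) μ := by
  simpa only [coe_ketBra, trace_rankOne_mul] using hX.aestronglyMeasurable (ketBra w u)

theorem lintegral_enorm_inner_le (hX : IsResolutionDensity μ X) (u w : H) :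
    ∫⁻ x, ‖⟪u, X x w⟫_ℂ‖ₑ ∂μ ≤ ENNReal.ofReal (1 / 2 * ‖u‖ ^ 2 + 1 / 2 * ‖w‖ ^ 2) := by
  have hm : ∀ v, AEMeasurable (fun x => ENNReal.ofReal (⟪v, X x v⟫_ℂ).re) μ := fun v =>
    (Complex.measurable_re.comp_aemeasurable
      (hX.aestronglyMeasurable_inner v v).aemeasurable).ennreal_ofReal
  have hnn : ∀ x v, 0 ≤ (⟪v, X x v⟫_ℂ).re := fun x v => (hX.isPositive x).re_inner_nonneg_right v
  calc ∫⁻ x, ‖⟪u, X x w⟫_ℂ‖ₑ ∂μ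
      ≤ ∫⁻ x, (ENNReal.ofReal (1 / 2) * ENNReal.ofReal (⟪u, X x u⟫_ℂ).re +
          ENNReal.ofReal (1 / 2) * ENNReal.ofReal (⟪w, X x w⟫_ℂ).re) ∂μ := by
        refine lintegral_mono fun x => ?_
        rw [← ENNReal.ofReal_mul (by norm_num), ← ENNReal.ofReal_mul (by norm_num),
          ← ENNReal.ofReal_add (mul_nonneg (by norm_num) (hnn x u))
            (mul_nonneg (by norm_num) (hnn x w)), ← ofReal_norm]
        exact ENNReal.ofReal_le_ofReal (norm_inner_le_of_isPositive (hX.isPositive x) u w)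
    _ = ENNReal.ofReal (1 / 2 * ‖u‖ ^ 2 + 1 / 2 * ‖w‖ ^ 2) := by
        rw [lintegral_add_left' ((hm u).const_mul _), lintegral_const_mul'' _ (hm u),
          lintegral_const_mul'' _ (hm w), hX.lintegral_inner, hX.lintegral_inner,
          ENNReal.ofReal_add (by positivity) (by positivity), ENNReal.ofReal_mul (by norm_num),
          ENNReal.ofReal_mul (by norm_num)]

/-- The basic `L¹` estimate: expand `S = V R²` as `∑ |V R bᵢ⟩⟨R bᵢ|` and sum the estimates for the
matrix elements of `X`. -/
theorem lintegral_enorm_trace_mul_le [TopologicalSpace.SeparableSpace H]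
    (hX : IsResolutionDensity μ X) (S : traceClass H) :
    ∫⁻ x, ‖trace ((S : H →L[ℂ] H) * X x)‖ₑ ∂μ ≤ traceNorm (S : H →L[ℂ] H) := by
  have := countable_basisIndex (H := H)
  obtain ⟨V, R, hV, hR, hS, hsum⟩ := exists_factorization (S : H →L[ℂ] H)
  have hRR := sq_mem_traceClass hR (hsum ▸ traceNorm_ne_top S)
  have hexp : ∀ x, trace ((S : H →L[ℂ] H) * X x) =
      ∑' i, ⟪R (onb H i), X x (V (R (onb H i)))⟫_ℂ := fun x => by
    have h := (isTraceNormBounded_trace_mul (X x)).hasSum hR hRR hS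
    simp only [LinearMap.comp_apply, traceLin_apply, coe_leftMul, coe_ketBra,
      trace_mul_rankOne] at h
    rw [trace_mul_comm S.2, h.tsum_eq]
  calc ∫⁻ x, ‖trace ((S : H →L[ℂ] H) * X x)‖ₑ ∂μ
      ≤ ∫⁻ x, ∑' i, ‖⟪R (onb H i), X x (V (R (onb H i)))⟫_ℂ‖ₑ ∂μ :=
        lintegral_mono fun x => by rw [hexp]; exact enorm_tsum_le_tsum_enorm
    _ = ∑' i, ∫⁻ x, ‖⟪R (onb H i), X x (V (R (onb H i)))⟫_ℂ‖ₑ ∂μ :=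
        lintegral_tsum fun i => (hX.aestronglyMeasurable_inner _ _).enorm
    _ ≤ ∑' i, ENNReal.ofReal (‖R (onb H i)‖ ^ 2) := by
        refine ENNReal.tsum_le_tsum fun i => (hX.lintegral_enorm_inner_le _ _).trans ?_
        refine ENNReal.ofReal_le_ofReal ?_
        have h1 : ‖V (R (onb H i))‖ ≤ ‖R (onb H i)‖ := by
          simpa using V.le_of_opNorm_le hV (R (onb H i))
        nlinarith [norm_nonneg (V (R (onb H i)))]
    _ = traceNorm (S : H →L[ℂ] H) := hsum

variable [TopologicalSpace.SeparableSpace H]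

theorem integrable_trace_mul (hX : IsResolutionDensity μ X) (S : traceClass H) :
    Integrable (fun x => trace ((S : H →L[ℂ] H) * X x)) μ :=
  ⟨hX.aestronglyMeasurable S, (hX.lintegral_enorm_trace_mul_le S).trans_lt S.2⟩

theorem integral_norm_trace_mul_le (hX : IsResolutionDensity μ X) (S : traceClass H) :
    ∫ x, ‖trace ((S : H →L[ℂ] H) * X x)‖ ∂μ ≤ (traceNorm (S : H →L[ℂ] H)).toReal := by
  rw [integral_norm_eq_lintegral_enorm (hX.aestronglyMeasurable S)]
  exact ENNReal.toReal_mono (traceNorm_ne_top S) (hX.lintegral_enorm_trace_mul_le S)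

theorem _root_.MeasureTheory.Lp.ae_norm_le_of_top (f : Lp ℂ ∞ μ) : ∀ᵐ x ∂μ, ‖f x‖ ≤ ‖f‖ := by
  have h := ae_le_lpNorm_exponent_top (Lp.memLp f)
  rwa [lpNorm, if_pos (Lp.aestronglyMeasurable f), ← Lp.norm_def] at h

theorem integrable_mul_trace_mul (hX : IsResolutionDensity μ X) (f : Lp ℂ ∞ μ)
    (S : traceClass H) : Integrable (fun x => f x * trace ((S : H →L[ℂ] H) * X x)) μ :=
  (hX.integrable_trace_mul S).bdd_mul (Lp.aestronglyMeasurable f) (Lp.ae_norm_le_of_top f)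

/-- The functional `S ↦ ∫ f Tr (S X)` on the trace class. -/
noncomputable def functional (hX : IsResolutionDensity μ X) (f : Lp ℂ ∞ μ) :
    traceClass H →ₗ[ℂ] ℂ where
  toFun S := ∫ x, f x * trace ((S : H →L[ℂ] H) * X x) ∂μ
  map_add' S S' := by
    rw [← integral_add (hX.integrable_mul_trace_mul f S) (hX.integrable_mul_trace_mul f S')]
    refine integral_congr_ae (.of_forall fun x => ?_)
    simp only [trace_mul_comm (Subtype.mem _)]
    rw [← mul_add]
    congr 1
    exact (traceLin ∘ₗ leftMul (X x)).map_add S S'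
  map_smul' c S := by
    rw [RingHom.id_apply, smul_eq_mul, ← integral_const_mul]
    refine integral_congr_ae (.of_forall fun x => ?_)
    simp only [Submodule.coe_smul, smul_mul_assoc, trace_smul]
    ring

theorem isTraceNormBounded_functional (hX : IsResolutionDensity μ X) (f : Lp ℂ ∞ μ) :
    IsTraceNormBounded (hX.functional f) := by
  refine ⟨‖f‖, fun S => (norm_integral_le_integral_norm _).trans ?_⟩
  calc ∫ x, ‖f x * trace ((S : H →L[ℂ] H) * X x)‖ ∂μ
      ≤ ∫ x, ‖f‖ * ‖trace ((S : H →L[ℂ] H) * X x)‖ ∂μ := by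
        refine integral_mono_ae (hX.integrable_mul_trace_mul f S).norm
          ((hX.integrable_trace_mul S).norm.const_mul _) ?_
        filter_upwards [Lp.ae_norm_le_of_top f] with x hx
        rw [norm_mul]
        gcongr
    _ ≤ ‖f‖ * (traceNorm (S : H →L[ℂ] H)).toReal := by
        rw [integral_const_mul]
        gcongr
        exact hX.integral_norm_trace_mul_le S

/-- Integration of bounded functions against the operator density `X`. -/
theorem exists_linearMap (hX : IsResolutionDensity μ X) :
    ∃ Γ : Lp ℂ ∞ μ →ₗ[ℂ] (H →L[ℂ] H), ∀ (f : Lp ℂ ∞ μ) (S : traceClass H),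
      trace ((S : H →L[ℂ] H) * Γ f) = ∫ x, f x * trace ((S : H →L[ℂ] H) * X x) ∂μ := by
  choose A hA using fun f => (hX.isTraceNormBounded_functional f).exists_eq_trace_mul
  refine ⟨{ toFun := A, map_add' := fun f f' => ?_, map_smul' := fun c f => ?_ },
    fun f S => (hA f S).symm⟩
  · refine eq_of_forall_trace_mul_eq fun S => ?_
    rw [trace_mul_add S.2, ← hA, ← hA, ← hA]
    change (∫ x, _ ∂μ) = (∫ x, _ ∂μ) + ∫ x, _ ∂μ
    rw [← integral_add (hX.integrable_mul_trace_mul f S) (hX.integrable_mul_trace_mul f' S)]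
    refine integral_congr_ae ?_
    filter_upwards [Lp.coeFn_add f f'] with x hx
    rw [hx, Pi.add_apply, add_mul]
  · refine eq_of_forall_trace_mul_eq fun S => ?_
    rw [RingHom.id_apply, trace_mul_smul, ← hA, ← hA]
    change (∫ x, _ ∂μ) = c * ∫ x, _ ∂μ
    rw [← integral_const_mul]
    refine integral_congr_ae ?_
    filter_upwards [Lp.coeFn_smul c f] with x hx
    rw [hx, Pi.smul_apply, smul_eq_mul, mul_assoc]

theorem integral_inner_self (hX : IsResolutionDensity μ X) (v : H) :
    ∫ x, ⟪v, X x v⟫_ℂ ∂μ = ⟪v, v⟫_ℂ := by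
  have hi : Integrable (fun x => ⟪v, X x v⟫_ℂ) μ := by
    simpa only [coe_ketBra, trace_rankOne_mul] using hX.integrable_trace_mul (ketBra v v)
  have hre : ∀ x, ⟪v, X x v⟫_ℂ = ((⟪v, X x v⟫_ℂ).re : ℂ) := fun x =>
    Complex.eq_re_of_ofReal_le ((hX.isPositive x).inner_nonneg_right v)
  have hnn : ∀ x, 0 ≤ (⟪v, X x v⟫_ℂ).re := fun x => (hX.isPositive x).re_inner_nonneg_right v
  rw [integral_congr_ae (.of_forall hre), integral_complex_ofReal,
    integral_eq_lintegral_of_nonneg_ae (.of_forall hnn) hi.re.aestronglyMeasurable,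
    hX.lintegral_inner, ENNReal.toReal_ofReal (by positivity), inner_self_eq_norm_sq_to_K]
  norm_cast

section Properties

variable {Γ : Lp ℂ ∞ μ →ₗ[ℂ] (H →L[ℂ] H)}

theorem map_one (hX : IsResolutionDensity μ X)
    (hΓ : ∀ (f : Lp ℂ ∞ μ) (S : traceClass H),
      trace ((S : H →L[ℂ] H) * Γ f) = ∫ x, f x * trace ((S : H →L[ℂ] H) * X x) ∂μ) :
    Γ (oneLInfty μ) = 1 := by
  have hv : ∀ v, ⟪v, Γ (oneLInfty μ) v⟫_ℂ = ⟪v, v⟫_ℂ := fun v => by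
    have h := hΓ (oneLInfty μ) (ketBra v v)
    simp only [coe_ketBra, trace_rankOne_mul] at h
    refine h.trans ((integral_congr_ae ?_).trans (hX.integral_inner_self v))
    filter_upwards [(memLp_top_const (μ := μ) (1 : ℂ)).coeFn_toLp] with x hx
    rw [oneLInfty, hx, one_mul]
  refine ContinuousLinearMap.coe_injective ((ext_inner_map _ _).1 fun v => ?_)
  change ⟪Γ (oneLInfty μ) v, v⟫_ℂ = ⟪v, v⟫_ℂ
  rw [← inner_conj_symm, hv, inner_conj_symm]

omit [TopologicalSpace.SeparableSpace H] in
theorem isPositiveMap (hX : IsResolutionDensity μ X)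
    (hΓ : ∀ (f : Lp ℂ ∞ μ) (S : traceClass H),
      trace ((S : H →L[ℂ] H) * Γ f) = ∫ x, f x * trace ((S : H →L[ℂ] H) * X x) ∂μ) :
    IsPositiveMap μ Γ := by
  intro f hf
  have hnn : ∀ v, 0 ≤ ⟪v, Γ f v⟫_ℂ := fun v => by
    have h := hΓ f (ketBra v v)
    simp only [coe_ketBra, trace_rankOne_mul] at h
    rw [h]
    refine integral_nonneg_of_ae ?_
    filter_upwards [hf] with x hx
    exact mul_nonneg hx ((hX.isPositive x).inner_nonneg_right v)
  refine (ContinuousLinearMap.isPositive_iff_complex _).2 fun v => ?_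
  obtain ⟨h1, h2⟩ := Complex.nonneg_iff.1 (hnn v)
  rw [← inner_conj_symm, RCLike.conj_re]
  refine ⟨?_, h1⟩
  rw [Complex.conj_eq_iff_im.2 h2.symm]
  exact (Complex.eq_re_of_ofReal_le (hnn v)).symm

theorem isNormalMap (hX : IsResolutionDensity μ X)
    (hΓ : ∀ (f : Lp ℂ ∞ μ) (S : traceClass H),
      trace ((S : H →L[ℂ] H) * Γ f) = ∫ x, f x * trace ((S : H →L[ℂ] H) * X x) ∂μ) :
    IsNormalMap μ Γ := by
  let := weakStarTopology μ
  let := ultraweakTopology H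
  refine continuous_induced_rng.2 (continuous_pi fun S => ?_)
  have h : (fun f : Lp ℂ ∞ μ => trace ((S : H →L[ℂ] H) * Γ f)) =
      (fun p : Lp ℂ 1 μ → ℂ => p (hX.integrable_trace_mul S).toL1) ∘
        fun (f : Lp ℂ ∞ μ) (h : Lp ℂ 1 μ) => ∫ x, f x * h x ∂μ := by
    funext f
    refine (hΓ f S).trans (integral_congr_ae ?_)
    filter_upwards [(hX.integrable_trace_mul S).coeFn_toL1] with x hx
    rw [hx]
  change Continuous fun f : Lp ℂ ∞ μ => trace ((S : H →L[ℂ] H) * Γ f)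
  rw [h]
  exact (continuous_apply _).comp continuous_induced_dom

theorem hasUltraweakIntegral_iff (hX : IsResolutionDensity μ X)
    (hΓ : ∀ (f : Lp ℂ ∞ μ) (S : traceClass H),
      trace ((S : H →L[ℂ] H) * Γ f) = ∫ x, f x * trace ((S : H →L[ℂ] H) * X x) ∂μ)
    (f : Lp ℂ ∞ μ) (A : H →L[ℂ] H) :
    HasUltraweakIntegral μ (fun x => f x • X x) A ↔ A = Γ f := by
  simp only [HasUltraweakIntegral, trace_mul_smul]
  constructor
  · intro h
    refine eq_of_forall_trace_mul_eq fun S => ?_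
    rw [← (h S).2, hΓ]
  · rintro rfl S
    exact ⟨hX.integrable_mul_trace_mul f S, (hΓ f S).symm⟩

end Properties

end IsResolutionDensity

end ResolutionDensity

/-! ### Orbits of a state and covariance -/

section Covariance

variable {G : Type*} [Group G] {H : Type*} [NormedAddCommGroup H] [InnerProductSpace ℂ H] [CompleteSpace H] {β : G →* traceAut H}

theorem map_symm_isPositive (β : G →* traceAut H) (g : G) (S : traceClass H)
    (hS : (S : H →L[ℂ] H).IsPositive) : ((β g).1.symm S : H →L[ℂ] H).IsPositive := by
  have h : (β g).1.symm S = (β g⁻¹).1 S := by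
    rw [LinearEquiv.symm_apply_eq, ← LinearEquiv.mul_apply, ← Submonoid.coe_mul, ← map_mul,
      mul_inv_cancel, map_one]
    rfl
  rw [h]
  exact (β g⁻¹).2.1 S hS

theorem trace_map_mul_map_mul (β : G →* traceAut H) (g x : G) (S T : traceClass H) :
    trace (((β g).1 S : H →L[ℂ] H) * ((β (g * x)).1 T : H →L[ℂ] H)) =
      trace ((S : H →L[ℂ] H) * ((β x).1 T : H →L[ℂ] H)) := by
  have h : (β (g * x)).1 T = (β g).1 ((β x).1 T) := by
    rw [map_mul]
    rfl
  rw [h]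
  exact trace_map_mul_map (β g).2.1 (map_symm_isPositive β g) (β g).2.2 S _

theorem continuous_trace_mul_map [TopologicalSpace G] (hβ : Continuous β) (A : H →L[ℂ] H)
    (S : traceClass H) :
    Continuous fun g => trace (A * ((β g).1 S : H →L[ℂ] H)) :=
  (continuous_apply (A, S)).comp (continuous_induced_dom.comp hβ)

theorem isOneDimProjection_rankOne {x : H} (hx : ‖x‖ = 1) :
    IsOneDimProjection (rankOne ℂ x x) := by
  refine ⟨isStarProjection_rankOne_self hx, ?_⟩
  have hx0 : x ≠ 0 := fun h => by simp [h] at hx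
  rw [← Module.rank_eq_one_iff_finrank_eq_one]
  exact rank_rankOne hx0 hx0

theorem isPositive_map_ketBra (β : G →* traceAut H) (g : G) (y : H) :
    ((β g).1 (ketBra y y) : H →L[ℂ] H).IsPositive :=
  (β g).2.1 _ (isPositive_rankOne_self y)

variable [MeasurableSpace G] {lam : Measure G}

/-- The orthogonality relation for unit vectors extends to all vectors by scaling. -/
theorem lintegral_inner_map_ketBra {d : ℝ} (hd : 0 < d)
    (hβd : ∀ P₁ P₂ : traceClass H, IsOneDimProjection (P₁ : H →L[ℂ] H) →
      IsOneDimProjection (P₂ : H →L[ℂ] H) →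
      ∫ g, trace ((P₁ : H →L[ℂ] H) * ((β g).1 P₂ : H →L[ℂ] H)) ∂lam = (d : ℂ)) (x y : H) :
    ∫⁻ g, ENNReal.ofReal (⟪x, ((β g).1 (ketBra y y) : H →L[ℂ] H) x⟫_ℂ).re ∂lam =
      ENNReal.ofReal (d * ‖x‖ ^ 2) * ENNReal.ofReal (‖y‖ ^ 2) := by
  have unit : ∀ x y : H, ‖x‖ = 1 → ‖y‖ = 1 →
      ∫⁻ g, ENNReal.ofReal (⟪x, ((β g).1 (ketBra y y) : H →L[ℂ] H) x⟫_ℂ).re ∂lam =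
        ENNReal.ofReal d := fun x y hx hy => by
    have h := hβd (ketBra x x) (ketBra y y) (isOneDimProjection_rankOne hx)
      (isOneDimProjection_rankOne hy)
    simp only [coe_ketBra, trace_rankOne_mul] at h
    -- The Bochner integral is not zero, so the integrand is integrable.
    have hi : Integrable (fun g => ⟪x, ((β g).1 (ketBra y y) : H →L[ℂ] H) x⟫_ℂ) lam := by
      by_contra hn
      rw [integral_undef hn] at h
      exact hd.ne (by exact_mod_cast h)
    refine (ofReal_integral_eq_lintegral_ofReal hi.re (.of_forall fun g =>
      (isPositive_map_ketBra β g y).re_inner_nonneg_right x)).symm.trans (congrArg _ ?_)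
    exact (integral_re hi).trans (by rw [h]; rfl)
  have scale : ∀ v : H, ∃ (c : ℂ) (e : H), (c = 0 ∨ ‖e‖ = 1) ∧ v = c • e := fun v => by
    rcases eq_or_ne v 0 with rfl | hv
    · exact ⟨0, 0, Or.inl rfl, by simp⟩
    · refine ⟨‖v‖, (‖v‖⁻¹ : ℂ) • v, Or.inr (norm_smul_inv_norm hv), ?_⟩
      rw [smul_smul, mul_inv_cancel₀ (by simpa using hv), one_smul]
  obtain ⟨a, e, hae, rfl⟩ := scale x
  obtain ⟨b, f, hbf, rfl⟩ := scale y
  have hval : ∀ g, (⟪a • e, ((β g).1 (ketBra (b • f) (b • f)) : H →L[ℂ] H) (a • e)⟫_ℂ).re =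
      (‖a‖ ^ 2 * ‖b‖ ^ 2) * (⟪e, ((β g).1 (ketBra f f) : H →L[ℂ] H) e⟫_ℂ).re := fun g => by
    rw [← Complex.re_ofReal_mul, ketBra_smul_self, (β g).1.map_smul, Submodule.coe_smul,
      smul_apply, map_smul, inner_smul_left, inner_smul_right, inner_smul_right]
    congr 1
    push_cast
    rw [← Complex.conj_mul' a]
    ring
  simp only [hval, ENNReal.ofReal_mul (show 0 ≤ ‖a‖ ^ 2 * ‖b‖ ^ 2 by positivity)]
  rw [lintegral_const_mul' _ _ ENNReal.ofReal_ne_top]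
  rcases hae with rfl | he
  · simp
  rcases hbf with rfl | hf
  · simp
  rw [unit e f he hf, norm_smul, norm_smul, he, hf, ← ENNReal.ofReal_mul (by positivity),
    ← ENNReal.ofReal_mul (by positivity)]
  congr 1
  ring

variable [TopologicalSpace G] [BorelSpace G] [TopologicalSpace.SeparableSpace H]

/-- Expanding `T = R²` as `∑ |R bᵢ⟩⟨R bᵢ|`, the orthogonality relation extends from pure states
to `T` by monotone convergence. -/
theorem lintegral_inner_map {d : ℝ} (hd : 0 < d) (hβ : Continuous β)
    (hβd : ∀ P₁ P₂ : traceClass H, IsOneDimProjection (P₁ : H →L[ℂ] H) →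
      IsOneDimProjection (P₂ : H →L[ℂ] H) →
      ∫ g, trace ((P₁ : H →L[ℂ] H) * ((β g).1 P₂ : H →L[ℂ] H)) ∂lam = (d : ℂ))
    (T : traceClass H) (hT : (T : H →L[ℂ] H).IsPositive) (x : H) :
    ∫⁻ g, ENNReal.ofReal (⟪x, ((β g).1 T : H →L[ℂ] H) x⟫_ℂ).re ∂lam =
      ENNReal.ofReal (d * ‖x‖ ^ 2) * traceNorm (T : H →L[ℂ] H) := by
  have := countable_basisIndex (H := H)
  have h0 : 0 ≤ (T : H →L[ℂ] H) := (ContinuousLinearMap.nonneg_iff_isPositive _).2 hT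
  set R := CFC.sqrt (T : H →L[ℂ] H) with hRdef
  have hR : R.adjoint = R := (CFC.sqrt_nonneg _).isSelfAdjoint
  have hRR : R * R = T := CFC.sqrt_mul_sqrt_self _ h0
  have hTR : (⟨R * R, hRR ▸ T.2⟩ : traceClass H) = T := Subtype.ext hRR
  have hsum : ∑' i, ENNReal.ofReal (‖R (onb H i)‖ ^ 2) = traceNorm (T : H →L[ℂ] H) := by
    rw [traceNorm, traceNormIn_eq, CFC.abs_of_nonneg _ h0]
  have hexp : ∀ g, ENNReal.ofReal (⟪x, ((β g).1 T : H →L[ℂ] H) x⟫_ℂ).re =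
      ∑' i, ENNReal.ofReal
        (⟪x, ((β g).1 (ketBra (R (onb H i)) (R (onb H i))) : H →L[ℂ] H) x⟫_ℂ).re := fun g => by
    have h := ((isTraceNormBounded_trace_mul (rankOne ℂ x x)).comp_isometry
      (β g).2.2).hasSum_of_sq hR (hRR ▸ T.2)
    rw [hTR] at h
    simp only [LinearMap.comp_apply, traceLin_apply, coe_leftMul, trace_rankOne_mul,
      LinearEquiv.coe_coe] at h
    have h' := Complex.hasSum_re h
    exact (congrArg _ h'.tsum_eq.symm).trans (ENNReal.ofReal_tsum_of_nonneg (fun i =>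
      (isPositive_map_ketBra β g _).re_inner_nonneg_right x) h'.summable)
  have hm : ∀ S : traceClass H,
      Measurable fun g => ENNReal.ofReal (⟪x, ((β g).1 S : H →L[ℂ] H) x⟫_ℂ).re := fun S => by
    have h := continuous_trace_mul_map hβ (rankOne ℂ x x) S
    simp only [trace_rankOne_mul] at h
    exact (Complex.continuous_re.comp h).measurable.ennreal_ofReal
  simp only [hexp]
  rw [lintegral_tsum fun i => (hm _).aemeasurable]
  simp only [lintegral_inner_map_ketBra hd hβd]
  rw [ENNReal.tsum_mul_left, hsum]

theorem isResolutionDensity_orbit [SecondCountableTopology G] {d : ℝ} (hd : 0 < d) (hβ : Continuous β)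
    (hβd : ∀ P₁ P₂ : traceClass H, IsOneDimProjection (P₁ : H →L[ℂ] H) →
      IsOneDimProjection (P₂ : H →L[ℂ] H) →
      ∫ g, trace ((P₁ : H →L[ℂ] H) * ((β g).1 P₂ : H →L[ℂ] H)) ∂lam = (d : ℂ))
    (T : traceClass H) (hT : (T : H →L[ℂ] H).IsPositive) (hT1 : trace (T : H →L[ℂ] H) = 1) :
    IsResolutionDensity lam fun g => (d : ℂ)⁻¹ • ((β g).1 T : H →L[ℂ] H) where
  isPositive g := by
    refine ((β g).2.1 T hT).smul_of_nonneg ?_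
    rw [← Complex.ofReal_inv]
    exact_mod_cast (inv_pos.2 hd).le
  aestronglyMeasurable S := by
    simp only [trace_mul_smul]
    exact ((continuous_trace_mul_map hβ S T).const_mul _ |>.measurable).aestronglyMeasurable
  lintegral_inner v := by
    have hnorm : traceNorm (T : H →L[ℂ] H) = 1 := by
      have h := trace_of_nonneg ((ContinuousLinearMap.nonneg_iff_isPositive _).2 hT)
      rw [hT1] at h
      rw [← ENNReal.toReal_eq_one_iff]
      exact_mod_cast h.symm
    have hval : ∀ g, (⟪v, ((d : ℂ)⁻¹ • ((β g).1 T : H →L[ℂ] H)) v⟫_ℂ).re =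
        d⁻¹ * (⟪v, ((β g).1 T : H →L[ℂ] H) v⟫_ℂ).re := fun g => by
      rw [smul_apply, inner_smul_right, ← Complex.ofReal_inv, Complex.re_ofReal_mul]
    simp only [hval, ENNReal.ofReal_mul (inv_pos.2 hd).le]
    rw [lintegral_const_mul' _ _ ENNReal.ofReal_ne_top, lintegral_inner_map hd hβ hβd T hT, hnorm,
      mul_one, ← ENNReal.ofReal_mul (inv_pos.2 hd).le, inv_mul_cancel_left₀ hd.ne']

end Covariance

end PhaseSpace

theorem theorem1 {G : Type*} [Group G] [TopologicalSpace G] [IsTopologicalGroup G]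
    [LocallyCompactSpace G] [SecondCountableTopology G] [T2Space G]
    [MeasurableSpace G] [BorelSpace G]
    (lam : Measure G) [lam.IsHaarMeasure] [lam.IsMulRightInvariant]
    {H : Type*} [NormedAddCommGroup H] [InnerProductSpace ℂ H] [CompleteSpace H]
    [TopologicalSpace.SeparableSpace H]
    (β : G →* PhaseSpace.traceAut H) (hβ : Continuous β)
    (d : ℝ) (hd : 0 < d)
    (hβd : ∀ P₁ P₂ : PhaseSpace.traceClass H,
      PhaseSpace.IsOneDimProjection (P₁ : H →L[ℂ] H) →
      PhaseSpace.IsOneDimProjection (P₂ : H →L[ℂ] H) →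
      ∫ g, PhaseSpace.trace ((P₁ : H →L[ℂ] H) * ((β g).1 P₂ : H →L[ℂ] H)) ∂lam = (d : ℂ))
    (T : PhaseSpace.traceClass H) (hT : (T : H →L[ℂ] H).IsPositive)
    (hT1 : PhaseSpace.trace (T : H →L[ℂ] H) = 1) :
    ∃ Γ : Lp ℂ ∞ lam →ₗ[ℂ] (H →L[ℂ] H),
      (∀ (f : Lp ℂ ∞ lam) (A : H →L[ℂ] H),
        PhaseSpace.HasUltraweakIntegral lam
          (fun g => ((d : ℂ)⁻¹ * f g) • ((β g).1 T : H →L[ℂ] H)) A ↔ A = Γ f) ∧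
      Γ (PhaseSpace.oneLInfty lam) = 1 ∧
      PhaseSpace.IsPositiveMap lam Γ ∧
      PhaseSpace.IsNormalMap lam Γ ∧
      PhaseSpace.IsCovariantMap lam β Γ := by
  have hX := PhaseSpace.isResolutionDensity_orbit hd hβ hβd T hT hT1
  obtain ⟨Γ, hΓ⟩ := hX.exists_linearMap
  refine ⟨Γ, fun f A => ?_, hX.map_one hΓ, hX.isPositiveMap hΓ, hX.isNormalMap hΓ, ?_⟩
  · simpa only [smul_smul, mul_comm] using hX.hasUltraweakIntegral_iff hΓ f A
  · intro g f S
    -- Substitute `x ↦ g x` in the right-hand side and cancel `β g` in the trace.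
    rw [hΓ, hΓ]
    refine (integral_congr_ae ?_).trans (integral_mul_left_eq_self _ g)
    filter_upwards [Lp.coeFn_compMeasurePreserving f (measurePreserving_mul_left lam g)] with x hx
    rw [PhaseSpace.translate, hx, PhaseSpace.trace_mul_smul, PhaseSpace.trace_mul_smul,
      PhaseSpace.trace_map_mul_map_mul]
    rfl
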